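/- Let $(\mathbf A_t)_{t\ge1}$ and $(\mathbf B_t)_{t\ge1}$ be two independent sequences of i.i.d. $\mathbb N$-valued random variables with probability generating functions $A(u)=\sum_n a_nu^n$, $B(u)=\sum_n b_nu^n$ and finite means $\lambda_A,\lambda_B$ such that $\lambda_A+\lambda_B<1$. Consider the tandem of two queues in discrete time defined by $\mathbf X_0=\mathbf Y_0=0$ and, for $t\ge0$, $$\mathbf X_{t+1}=(\mathbf X_t-1)_++\mathbf A_{t+1},\qquad \mathbf Y_{t+1}=(\mathbf Y_t-1)_++\mathbf B_{t+1}+\mathbf 1_{\{\mathbf X_t>0\}},$$ where $(x)_+=\max(x,0)$. Let $T_A(u)=\sum_{n}\mathbb P(\text{total size}=n)\,u^n$, where the total size is the number of nodes of the Galton–Watson tree whose offspring distribution has generating function $A$. Let $\delta$ be the largest solution $v\ge0$ of $v=T_A(B(v))$ (among the $v$ at which the series $B(v)$ and $T_A(B(v))$ converge), and assume that $\delta>1$ and that $T_A\circ B$ is defined in a neighbourhood of $\delta$ and differentiable at $\delta$. Then the Markov chain $(\mathbf X_t,\mathbf Y_t)$ has a unique stationary distribution $\pi$ on $\mathbb N^2$,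 the law of $(\mathbf X_t,\mathbf Y_t)$ converges to $\pi$ as $t\to\infty$ (that is, $\mathbb P(\mathbf X_t=n,\mathbf Y_t=m)\to\pi(n,m)$ for all $n,m$), and if $(\mathbf X,\mathbf Y)\sim\pi$ then $$\mathbb P(\mathbf Y\ge R)\underset{R\to\infty}{\sim}\frac{(1-\lambda_A-\lambda_B)\,\delta(\delta-1)}{(1-B(\delta))\,\bigl(1-(T_A\circ B)'(\delta)\bigr)}\;\delta^{-R}.$$ -/

import Mathlib

open MeasureTheory ProbabilityTheory Filter Asymptotics
open scoped Topology

namespace TandemQueue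

/-- Probability generating function `u ↦ ∑ₙ aₙ uⁿ` of a law `a` on `ℕ`
(meaningful at `u` when the series converges there). -/
noncomputable def genFun (a : PMF ℕ) (u : ℝ) : ℝ :=
  ∑' n : ℕ, (a n).toReal * u ^ n

/-- Finite rooted plane trees: a root together with an ordered finite family of subtrees. -/
inductive PlaneTree : Type
  | node (k : ℕ) (child : Fin k → PlaneTree) : PlaneTree

/-- Number of nodes of a tree. -/
def PlaneTree.size : PlaneTree → ℕ
  | .node _ child => 1 + ∑ i, (child i).size

/-- Probability that the Galton-Watson tree with offspring law `a` equals the given finite tree: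
the product over all nodes of the probability of their number of children. -/
noncomputable def PlaneTree.prob (a : PMF ℕ) : PlaneTree → ℝ
  | .node k child => (a k).toReal * ∏ i, (child i).prob a

/-- Generating function `T_A` of the number of nodes of the Galton-Watson tree with
offspring law `a`: `T_A(u) = ∑ₙ P(size = n) uⁿ`, grouped tree by tree. -/
noncomputable def treeGenFun (a : PMF ℕ) (u : ℝ) : ℝ :=
  ∑' τ : PlaneTree, τ.prob a * u ^ τ.size

/-- The solutions `v ≥ 0` of `v = T_A(B(v))` at which both series converge. -/
def fixedPoints (a b : PMF ℕ) : Set ℝ :=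
  {v | 0 ≤ v ∧ Summable (fun n : ℕ => (b n).toReal * v ^ n) ∧
    Summable (fun τ : PlaneTree => τ.prob a * genFun b v ^ τ.size) ∧
    treeGenFun a (genFun b v) = v}

/-- One time slot of the tandem network, from occupancies `s = (x, y)` with `i` external arrivals
at queue 1 and `j` at queue 2. Subtraction in `ℕ` is truncated, so `s.1 - 1` is `(x - 1)₊`. -/
def step (s : ℕ × ℕ) (i j : ℕ) : ℕ × ℕ :=
  (s.1 - 1 + i, s.2 - 1 + j + if 0 < s.1 then 1 else 0)

/-- The occupancies `(X_t, Y_t)` at the end of time slot `t`, from an empty network. Here `A t`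
and `B t` are the numbers of external arrivals during time slot `t + 1`. -/
def occupancy {Ω : Type*} (A B : ℕ → Ω → ℕ) : ℕ → Ω → ℕ × ℕ
  | 0, _ => (0, 0)
  | t + 1, ω => step (occupancy A B t ω) (A t ω) (B t ω)

/-- The transition law of the Markov chain `(X_t, Y_t)`: independent arrivals of laws `a`, `b`. -/
noncomputable def transition (a b : PMF ℕ) (s : ℕ × ℕ) : PMF (ℕ × ℕ) :=
  a.bind fun i => b.map fun j => step s i j

/-- `π` is a stationary distribution of the Markov chain `(X_t, Y_t)`. -/
def IsStationary (a b : PMF ℕ) (π : PMF (ℕ × ℕ)) : Prop :=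
  π.bind (transition a b) = π

end TandemQueue

/-!
The theorem is an instance of renewal theory, once the generating function of the second queue is
known. All generating functions have coefficients in `[0, ∞]`, so that they are defined everywhere
and may be rearranged freely.

*The chain.* One time slot is a monotone map of the state. Started from the empty network, the
chain is therefore stochastically increasing, the probabilities of lower sets decrease, and the
laws converge pointwise (`exists_tendsto_law`). Since the mean occupancies are finite and increase,
each queue is busy with at most the probability given by its load (`busy_le`); this keeps the
probability of `(0, 0)` away from `0`. The limit is invariant by Fatou's lemma, and it has mass one
because every stationary law dominates the chain started from the empty state
(`exists_stationary`). Uniqueness holds because the minimum of two stationary laws is invariant and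
`(0, 0)` can be reached from everywhere (`stationary_unique`).

*The kernel method.* Write `f = T_A ∘ B` and `κ = P(Y = 0)`. If the second queue is empty, the first
one holds only fresh arrivals, so `E[x^X; Y = 0] = κ A(x)`. In the functional equation for
`E[x^X y^Y]` the only unknown left is `E[y^Y; X = 0]`, which is found on the curve `x = f(y)` where
the kernel `x - A(x) B(y)` vanishes, by the branching equation `T_A(u) = u A(T_A(u))`. With
`S(u) = (1 - T_A(u)) / (1 - u)` and `Q(y) = (1 - f(y)) / (1 - y)` the result is

  `E[y^Y] = κ (1 - y) + κ y S(B(y)) / (1 - Q(y))`,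

a renewal equation with nonnegative data (`renewal_equation`). Its value at `y = 1` gives
`κ = 1 - λ_A - λ_B` (`empty_probability`).

*The asymptotics.* The equation `f(δ) = δ` says that `Q(δ) = 1`, so the coefficients of `Q` tilted
by `δⁿ` form a probability law. It charges `1`, and its mean is `δ Q'(δ)`, finite because `f` is a
convergent power series beyond `δ`. The renewal theorem (`tendsto_renewal`) then gives
`P(Y = n) δⁿ → κ S(B(δ)) / Q'(δ)`, and summing the tail gives the claim.
-/

open scoped ENNReal

namespace TandemQueue

/-! ### Generating functions with coefficients in `[0, ∞]` -/

/-- The generating function `∑ₙ cₙ yⁿ` in `[0, ∞]`, where every rearrangement is allowed. -/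
noncomputable def egf (c : ℕ → ℝ≥0∞) (y : ℝ≥0∞) : ℝ≥0∞ := ∑' n, c n * y ^ n

/-- Cauchy product of two sequences. -/
noncomputable def conv (c d : ℕ → ℝ≥0∞) (n : ℕ) : ℝ≥0∞ :=
  ∑ p ∈ Finset.HasAntidiagonal.antidiagonal n, c p.1 * d p.2

/-- Sequence delayed by one, the coefficients of `y ↦ y * egf c y`. -/
def shift (c : ℕ → ℝ≥0∞) : ℕ → ℝ≥0∞
  | 0 => 0
  | n + 1 => c n

/-- Coefficients of the powers of a generating function. -/
noncomputable def powCoeff (b : ℕ → ℝ≥0∞) : ℕ → ℕ → ℝ≥0∞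
  | 0 => Pi.single 0 1
  | m + 1 => conv b (powCoeff b m)

/-- Coefficients of the composition `y ↦ egf c (egf b y)`. -/
noncomputable def compCoeff (c b : ℕ → ℝ≥0∞) (n : ℕ) : ℝ≥0∞ := ∑' m, c m * powCoeff b m n

/-- Tails `∑_{m > n} cₘ`. -/
noncomputable def tail (c : ℕ → ℝ≥0∞) (n : ℕ) : ℝ≥0∞ := ∑' k, c (n + 1 + k)

lemma egf_conv (c d : ℕ → ℝ≥0∞) (y : ℝ≥0∞) : egf (conv c d) y = egf c y * egf d y := by
  simp only [egf, conv]
  rw [← ENNReal.tsum_mul_right]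
  simp_rw [← ENNReal.tsum_mul_left]
  rw [← ENNReal.tsum_prod, ← Finset.HasAntidiagonal.sigmaAntidiagonalEquivProd.tsum_eq,
    ENNReal.tsum_sigma']
  refine tsum_congr fun n => ?_
  rw [tsum_fintype, Finset.sum_mul, ← Finset.sum_coe_sort]
  refine Finset.sum_congr rfl fun p _ => ?_
  have hp := Finset.HasAntidiagonal.mem_antidiagonal.1 p.2
  simp only [Finset.HasAntidiagonal.sigmaAntidiagonalEquivProd_apply]
  rw [show y ^ n = y ^ p.1.1 * y ^ p.1.2 by rw [← pow_add, hp]]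
  ring

lemma egf_succ (c : ℕ → ℝ≥0∞) (y : ℝ≥0∞) :
    egf c y = c 0 + y * egf (fun n => c (n + 1)) y := by
  rw [egf, tsum_eq_zero_add' ENNReal.summable, egf, ← ENNReal.tsum_mul_left]
  simp only [pow_zero, mul_one]
  congr 1
  exact tsum_congr fun n => by ring

lemma egf_shift (c : ℕ → ℝ≥0∞) (y : ℝ≥0∞) : egf (shift c) y = y * egf c y := by
  rw [egf_succ]; simp [shift]

lemma egf_single (y : ℝ≥0∞) : egf (Pi.single 0 1) y = 1 := by
  rw [egf, tsum_eq_single 0]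
  · simp
  · intro n hn; simp [hn]

lemma egf_zero (c : ℕ → ℝ≥0∞) : egf c 0 = c 0 := by simp [egf_succ c 0]

lemma egf_one (c : ℕ → ℝ≥0∞) : egf c 1 = ∑' n, c n := by simp [egf]

lemma egf_add (c d : ℕ → ℝ≥0∞) (y : ℝ≥0∞) : egf (c + d) y = egf c y + egf d y := by
  simp only [egf, Pi.add_apply, add_mul, ENNReal.tsum_add]

lemma egf_smul (r : ℝ≥0∞) (c : ℕ → ℝ≥0∞) (y : ℝ≥0∞) :
    egf (fun n => r * c n) y = r * egf c y := by
  simp only [egf, mul_assoc, ENNReal.tsum_mul_left]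

lemma egf_mono (c : ℕ → ℝ≥0∞) : Monotone (egf c) := fun x y h =>
  ENNReal.tsum_le_tsum fun n => by gcongr

lemma egf_powCoeff (b : ℕ → ℝ≥0∞) (m : ℕ) (y : ℝ≥0∞) : egf (powCoeff b m) y = egf b y ^ m := by
  induction m with
  | zero => simpa [powCoeff] using egf_single y
  | succ m ih => rw [powCoeff, egf_conv, ih, pow_succ']

lemma egf_compCoeff (c b : ℕ → ℝ≥0∞) (y : ℝ≥0∞) :
    egf (compCoeff c b) y = egf c (egf b y) := by
  rw [egf, egf]
  simp only [compCoeff, ← egf_powCoeff]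
  simp_rw [egf, ← ENNReal.tsum_mul_left, ← ENNReal.tsum_mul_right]
  rw [ENNReal.tsum_comm]
  simp only [mul_assoc]

lemma tail_zero_add (c : ℕ → ℝ≥0∞) : c 0 + tail c 0 = ∑' n, c n := by
  rw [tsum_eq_zero_add' (f := c) ENNReal.summable, tail]
  simp only [add_comm]

lemma tail_succ_add (c : ℕ → ℝ≥0∞) (n : ℕ) : c (n + 1) + tail c (n + 1) = tail c n := by
  rw [tail, tail, tsum_eq_zero_add' (f := fun k => c (n + 1 + k)) ENNReal.summable]
  simp only [add_zero]
  congr 1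
  exact tsum_congr fun k => by congr 1; ring

/-- The identity `1 - C(y) = (1 - y) ∑ₙ P(> n) yⁿ` for a probability generating function `C`,
in a subtraction-free form which is valid for all `y`. -/
lemma egf_add_egf_tail (c : ℕ → ℝ≥0∞) (y : ℝ≥0∞) :
    egf c y + egf (tail c) y = (∑' n, c n) + y * egf (tail c) y := by
  rw [← egf_add, egf_succ]
  simp only [Pi.add_apply, tail_zero_add, tail_succ_add]

/-- The tail series converges wherever the series itself does, beyond `1`. -/
lemma egf_tail_ne_top (c : ℕ → ℝ≥0∞) {y : ℝ≥0∞} (hy : 1 < y) (h : egf c y ≠ ∞) (hy' : y ≠ ∞) :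
    egf (tail c) y ≠ ∞ := by
  have hy0 : y ≠ 0 := (zero_lt_one.trans hy).ne'
  have key : egf (tail c) y ≤ ∑' k : ℕ, y⁻¹ ^ (k + 1) * egf c y := by
    rw [egf]
    simp only [tail, ← ENNReal.tsum_mul_right]
    rw [ENNReal.tsum_comm]
    refine ENNReal.tsum_le_tsum fun k => ?_
    have : ∀ n, c (n + 1 + k) * y ^ n = y⁻¹ ^ (k + 1) * (c (n + (k + 1)) * y ^ (n + (k + 1))) := by
      intro n
      have h1 : y⁻¹ ^ (k + 1) * y ^ (k + 1) = 1 := by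
        rw [← mul_pow, ENNReal.inv_mul_cancel hy0 hy', one_pow]
      calc c (n + 1 + k) * y ^ n = c (n + (k + 1)) * y ^ n * (y⁻¹ ^ (k + 1) * y ^ (k + 1)) := by
            rw [h1, mul_one]; congr 2; ring
        _ = _ := by rw [pow_add]; ring
    simp only [this, ENNReal.tsum_mul_left]
    gcongr
    exact ENNReal.tsum_comp_le_tsum_of_injective (add_left_injective (k + 1))
      (fun n => c n * y ^ n)
  refine ne_top_of_le_ne_top ?_ key
  rw [ENNReal.tsum_mul_right, ENNReal.tsum_geometric_add_one]
  have hlt : y⁻¹ < 1 := ENNReal.inv_lt_one.2 hy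
  refine ENNReal.mul_ne_top (ENNReal.mul_ne_top hlt.ne_top ?_) h
  exact ENNReal.inv_ne_top.2 (tsub_pos_of_lt hlt).ne'

/-- The sum of the tails is the mean. -/
lemma egf_tail_one (c : ℕ → ℝ≥0∞) : egf (tail c) 1 = ∑' n : ℕ, (n : ℝ≥0∞) * c n := by
  rw [egf_one, tsum_eq_zero_add' (f := fun n : ℕ => (n : ℝ≥0∞) * c n) ENNReal.summable]
  simp only [tail]
  rw [← ENNReal.tsum_prod (f := fun n k => c (n + 1 + k)),
    ← Finset.HasAntidiagonal.sigmaAntidiagonalEquivProd.tsum_eq, ENNReal.tsum_sigma']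
  simp only [Nat.cast_zero, zero_mul, zero_add]
  refine tsum_congr fun n => ?_
  rw [tsum_fintype, Finset.sum_congr rfl (g := fun _ => c (n + 1))]
  · simp
  · intro p _
    have hp := Finset.HasAntidiagonal.mem_antidiagonal.1 p.2
    simp only [Finset.HasAntidiagonal.sigmaAntidiagonalEquivProd_apply]
    congr 1; omega

/-- Two generating functions which are finite and agree on `(0, 1)` have the same coefficients. -/
lemma eq_of_egf_eq {c d : ℕ → ℝ≥0∞} (h : ∀ y, 0 < y → y < 1 → egf c y = egf d y)
    (hfin : ∀ y, 0 < y → y < 1 → egf c y ≠ ∞) : c = d := by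
  have le0 : ∀ {c d : ℕ → ℝ≥0∞}, (∀ y, 0 < y → y < 1 → egf c y = egf d y) →
      (∀ y, 0 < y → y < 1 → egf d y ≠ ∞) → c 0 ≤ d 0 := by
    intro c d h hfin
    set M := egf (fun n => d (n + 1)) 2⁻¹
    have h2 : (2⁻¹ : ℝ≥0∞) < 1 := by simp
    have hM : M ≠ ∞ := by
      have := hfin 2⁻¹ (by simp) h2
      rw [egf_succ] at this
      intro hM
      apply this
      simp [M] at hM
      simp [hM]
    have lim : Tendsto (fun y : ℝ≥0∞ => d 0 + y * M) (𝓝[>] 0) (𝓝 (d 0 + 0 * M)) := by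
      refine Tendsto.mono_left ?_ nhdsWithin_le_nhds
      exact tendsto_const_nhds.add (ENNReal.Tendsto.mul_const tendsto_id (Or.inr hM))
    simp only [zero_mul, add_zero] at lim
    refine ge_of_tendsto lim ?_
    have : ∀ᶠ y : ℝ≥0∞ in 𝓝[>] 0, y < 2⁻¹ :=
      nhdsWithin_le_nhds (Iio_mem_nhds (by simp))
    filter_upwards [this, self_mem_nhdsWithin] with y hy hy0
    calc c 0 ≤ egf c y := by rw [egf_succ]; exact le_self_add
      _ = egf d y := h y hy0 (hy.trans h2)
      _ ≤ d 0 + y * M := by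
        rw [egf_succ]
        gcongr
        exact egf_mono _ hy.le
  funext n
  induction n generalizing c d with
  | zero =>
    exact le_antisymm (le0 h fun y h0 h1 => h y h0 h1 ▸ hfin y h0 h1)
      (le0 (fun y h0 h1 => (h y h0 h1).symm) hfin)
  | succ n ih =>
    have e0 : c 0 = d 0 := le_antisymm (le0 h fun y h0 h1 => h y h0 h1 ▸ hfin y h0 h1)
      (le0 (fun y h0 h1 => (h y h0 h1).symm) hfin)
    refine ih (c := fun n => c (n + 1)) (d := fun n => d (n + 1)) ?_ ?_
    · intro y h0 h1
      have e := h y h0 h1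
      have f := hfin y h0 h1
      rw [egf_succ] at f
      rw [egf_succ c, egf_succ d, e0] at e
      have c0 : d 0 ≠ ∞ := e0 ▸ (ENNReal.add_ne_top.1 f).1
      exact (ENNReal.mul_right_inj h0.ne' h1.ne_top).1 ((ENNReal.add_right_inj c0).1 e)
    · intro y h0 h1 ht
      have f := hfin y h0 h1
      rw [egf_succ] at f
      exact f (by simp [ht, h0.ne'])

/-! ### The renewal theorem -/

open Finset in
/-- Summation by parts in the renewal equation: weighting the past values by the tails `Qt` of `q`
gives a quantity which changes only by the input `r`. -/
lemma renewal_tail_identity {q r w Qt : ℕ → ℝ}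
    (hQ0 : q 0 + Qt 0 = 1) (hQ : ∀ n, q (n + 1) + Qt (n + 1) = Qt n)
    (hw : ∀ n, w n = ∑ k ∈ range (n + 1), q k * w (n - k) + r n) (n : ℕ) :
    ∑ k ∈ range (n + 1), Qt k * w (n - k) = ∑ k ∈ range (n + 1), r k := by
  induction n with
  | zero =>
    have := hw 0
    simp at this ⊢
    linear_combination w 0 * hQ0 + this
  | succ n ih =>
    rw [sum_range_succ r, ← ih]
    have h1 := hw (n + 1)
    rw [sum_range_succ'] at h1 ⊢
    simp only [Nat.add_sub_add_right, Nat.sub_zero] at h1 ⊢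
    have h2 : ∑ k ∈ range (n + 1), Qt k * w (n - k) =
        ∑ k ∈ range (n + 1), q (k + 1) * w (n - k) +
          ∑ k ∈ range (n + 1), Qt (k + 1) * w (n - k) := by
      rw [← sum_add_distrib]
      exact sum_congr rfl fun k _ => by rw [← hQ k]; ring
    rw [h2]
    linear_combination w (n + 1) * hQ0 + h1

open Finset in
/-- The values of a solution of the renewal equation one step before it comes close to its
upper limit are themselves close to the upper limit, because a jump of size one has positive
probability. -/
lemma tendsto_pred_of_limsup {q r w : ℕ → ℝ} {L : ℝ} (hq : ∀ n, 0 ≤ q n) (hqs : HasSum q 1)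
    (hq1 : 0 < q 1) (hr : Tendsto r atTop (𝓝 0)) {M : ℝ} (hM : ∀ n, |w n| ≤ M)
    (hw : ∀ n, w n = ∑ k ∈ range (n + 1), q k * w (n - k) + r n)
    (hL : ∀ ε > 0, ∀ᶠ n in atTop, w n < L + ε)
    {F : Filter ℕ} (hF : F ≤ atTop) (hFL : Tendsto w F (𝓝 L)) :
    Tendsto (fun n => w (n - 1)) F (𝓝 L) := by
  rw [Metric.tendsto_nhds]
  intro ε hε
  -- a margin so small that the loss on all other jumps is dominated by the gain on the unit jump
  set η : ℝ := q 1 * ε / (2 * (4 + M + |L|)) with hη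
  have hM0 : 0 ≤ M := (abs_nonneg _).trans (hM 0)
  have hden : 0 < 4 + M + |L| := by positivity
  have hηpos : 0 < η := by positivity
  have hq1le : q 1 ≤ 1 := le_hasSum hqs 1 fun j _ => hq j
  have hηε : η < ε := by
    rw [hη, div_lt_iff₀ (by positivity)]
    nlinarith [abs_nonneg L]
  have hup := hL η hηpos
  obtain ⟨N, hN⟩ := eventually_atTop.1 hup
  have hqt : Tendsto (fun n => ∑ k ∈ range n, q k) atTop (𝓝 1) := hqs.tendsto_sum_nat
  obtain ⟨K, hK⟩ := eventually_atTop.1 (hqt.eventually (lt_mem_nhds (show 1 - η < 1 by linarith)))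
  set K' := max K 2
  have hK' := hK K' (le_max_left _ _)
  have hK2 : 2 ≤ K' := le_max_right _ _
  have h1 : ∀ᶠ n in F, N + K' ≤ n := hF (eventually_ge_atTop _)
  have h2 : ∀ᶠ n in F, L - η < w n := hFL.eventually (lt_mem_nhds (by linarith))
  have h3 : ∀ᶠ n in F, r n < η := hF (hr.eventually (gt_mem_nhds hηpos))
  filter_upwards [h1, h2, h3] with n hn hwn hrn
  have hu : w (n - 1) < L + η := hN _ (by omega)
  rw [Real.dist_eq, abs_lt]
  refine ⟨?_, by linarith⟩
  -- split the renewal sum into the jumps below `K'`, among them the unit jump, and the others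
  have hs := hw n
  rw [show n + 1 = K' + (n + 1 - K') by omega, sum_range_add] at hs
  have htail : ∑ x ∈ range (n + 1 - K'), q (K' + x) ≤ η := by
    have := sum_le_hasSum (range (K' + (n + 1 - K'))) (fun j _ => hq j) hqs
    rw [sum_range_add] at this
    linarith
  have hb : ∑ x ∈ range (n + 1 - K'), q (K' + x) * w (n - (K' + x)) ≤ η * M := by
    calc _ ≤ ∑ x ∈ range (n + 1 - K'), q (K' + x) * M :=
          sum_le_sum fun x _ => mul_le_mul_of_nonneg_left ((le_abs_self _).trans (hM _)) (hq _)
      _ ≤ η * M := by rw [← sum_mul]; exact mul_le_mul_of_nonneg_right htail hM0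
  have ha : ∑ k ∈ range K', q k * w (n - k) ≤
      (∑ k ∈ range K', q k) * (L + η) + q 1 * (w (n - 1) - (L + η)) := by
    have hmem : 1 ∈ range K' := mem_range.2 (by omega)
    rw [← add_sum_erase _ _ hmem, ← add_sum_erase (range K') q hmem, add_mul, sum_mul]
    have : ∑ k ∈ (range K').erase 1, q k * w (n - k) ≤ ∑ k ∈ (range K').erase 1, q k * (L + η) :=
      sum_le_sum fun k hk => mul_le_mul_of_nonneg_left
        (hN _ (by have := mem_range.1 (mem_of_mem_erase hk); omega)).le (hq _)
    linarith
  have hsum1 : ∑ k ∈ range K', q k ≤ 1 := sum_le_hasSum _ (fun j _ => hq j) hqs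
  have hc : (∑ k ∈ range K', q k) * (L + η) ≤ L + η + η * |L| := by
    have h5 : (1 - ∑ k ∈ range K', q k) * (-L) ≤ η * |L| :=
      (mul_le_mul_of_nonneg_left (neg_le_abs L) (by linarith)).trans
        (mul_le_mul_of_nonneg_right (by linarith) (abs_nonneg L))
    nlinarith
  have hfin : η * (2 * (4 + M + |L|)) = q 1 * ε := by
    rw [hη]; field_simp
  have : q 1 * (-ε) < q 1 * (w (n - 1) - L) := by nlinarith [abs_nonneg L]
  exact lt_of_mul_lt_mul_left this hq1.le

open Finset in
/-- The upper limit of a bounded solution of the renewal equation is the total input divided by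
the mean `μ = ∑ Qt`: along a subsequence realizing the upper limit all fixed translates converge
to it, and the conserved quantity `renewal_tail_identity` passes to the limit. -/
lemma exists_renewal_upper {q r w Qt : ℕ → ℝ} {μ ρ M : ℝ} (hq : ∀ n, 0 ≤ q n) (hqs : HasSum q 1)
    (hq1 : 0 < q 1) (hQ0 : q 0 + Qt 0 = 1) (hQ : ∀ n, q (n + 1) + Qt (n + 1) = Qt n)
    (hQt : ∀ n, 0 ≤ Qt n) (hQs : HasSum Qt μ) (hr : HasSum r ρ) (hM : ∀ n, |w n| ≤ M)
    (hw : ∀ n, w n = ∑ k ∈ range (n + 1), q k * w (n - k) + r n) :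
    ∃ L, μ * L = ρ ∧ ∀ ε > 0, ∀ᶠ n in atTop, w n < L + ε := by
  set L := limsup w atTop
  have hbd : IsBoundedUnder (· ≤ ·) atTop w :=
    isBoundedUnder_of ⟨M, fun n => (le_abs_self _).trans (hM n)⟩
  have hbd' : IsBoundedUnder (· ≥ ·) atTop w :=
    isBoundedUnder_of ⟨-M, fun n => (abs_le.1 (hM n)).1⟩
  have hup : ∀ ε > 0, ∀ᶠ n in atTop, w n < L + ε := fun ε hε =>
    eventually_lt_of_limsup_lt (by linarith) hbd
  refine ⟨L, ?_, hup⟩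
  have hfreq : ∀ ε > 0, ∃ᶠ n in atTop, L - ε < w n := fun ε hε =>
    frequently_lt_of_lt_limsup hbd'.isCoboundedUnder_flip (by linarith)
  have hcl : MapClusterPt L atTop w := by
    rw [mapClusterPt_iff_frequently]
    intro s hs
    obtain ⟨ε, hε, hs⟩ := Metric.mem_nhds_iff.1 hs
    refine ((hfreq ε hε).and_eventually (hup ε hε)).mono fun n hn => hs ?_
    rw [Metric.mem_ball, Real.dist_eq, abs_lt]
    constructor <;> linarith [hn.1, hn.2]
  set F := atTop ⊓ comap w (𝓝 L) with hFdef
  have hne : F.NeBot := by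
    rw [hFdef, Filter.neBot_inf_comap_iff_map, inf_comm]
    exact hcl
  have hF : F ≤ atTop := inf_le_left
  have hFL : Tendsto w F (𝓝 L) := tendsto_iff_comap.2 inf_le_right
  have htrans : ∀ k : ℕ, ∀ F : Filter ℕ, F ≤ atTop → Tendsto w F (𝓝 L) →
      Tendsto (fun n => w (n - k)) F (𝓝 L) := by
    intro k
    induction k with
    | zero => intro F _ h; simpa using h
    | succ k ih =>
      intro F hF h
      have h1 : map (fun n => n - 1) F ≤ atTop :=
        (map_mono hF).trans (tendsto_sub_atTop_nat 1)
      have h2 := ih (map (fun n => n - 1) F) h1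
        (tendsto_pred_of_limsup hq hqs hq1 hr.summable.tendsto_atTop_zero hM hw hup hF h)
      refine (tendsto_map'_iff.1 h2).congr fun n => ?_
      simp only [Function.comp]
      congr 1; omega
  have hM0 : 0 ≤ M := (abs_nonneg _).trans (hM 0)
  have hdom : Tendsto (fun n => ∑' k, if k ∈ range (n + 1) then Qt k * w (n - k) else 0) F
      (𝓝 (∑' k, Qt k * L)) := by
    refine tendsto_tsum_of_dominated_convergence (bound := fun k => Qt k * M)
      (hQs.summable.mul_right M) (fun k => ?_) (Eventually.of_forall fun n k => ?_)
    · refine ((htrans k F hF hFL).const_mul (Qt k)).congr' ?_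
      filter_upwards [hF (eventually_ge_atTop k)] with n hn
      rw [if_pos (mem_range.2 (by omega))]
    · split_ifs
      · rw [norm_mul, Real.norm_of_nonneg (hQt k)]
        exact mul_le_mul_of_nonneg_left (hM _) (hQt k)
      · simpa using mul_nonneg (hQt k) hM0
  have hdom' : Tendsto (fun n => ∑ k ∈ range (n + 1), r k) F (𝓝 (μ * L)) := by
    rw [tsum_mul_right, hQs.tsum_eq] at hdom
    refine hdom.congr fun n => ?_
    rw [← renewal_tail_identity hQ0 hQ hw, tsum_eq_sum (s := range (n + 1))]
    · exact sum_congr rfl fun k hk => if_pos hk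
    · exact fun k hk => if_neg hk
  refine tendsto_nhds_unique hdom' ?_
  exact (hr.tendsto_sum_nat.comp (tendsto_add_atTop_nat 1)).mono_left hF

open Finset in
/-- The key renewal theorem for a step law `q` charging `1` whose tails `Qt` have the finite sum
`μ`, that is, whose mean is `μ`. -/
theorem tendsto_renewal {q r w Qt : ℕ → ℝ} {μ ρ M : ℝ} (hq : ∀ n, 0 ≤ q n) (hqs : HasSum q 1)
    (hq1 : 0 < q 1) (hQ0 : q 0 + Qt 0 = 1) (hQ : ∀ n, q (n + 1) + Qt (n + 1) = Qt n)
    (hQt : ∀ n, 0 ≤ Qt n) (hQs : HasSum Qt μ) (hr : HasSum r ρ) (hM : ∀ n, |w n| ≤ M)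
    (hw : ∀ n, w n = ∑ k ∈ range (n + 1), q k * w (n - k) + r n) :
    Tendsto w atTop (𝓝 (ρ / μ)) := by
  have hμ : 0 < μ := by
    have := le_hasSum hQs 0 fun j _ => hQt j
    linarith [hQ 0, hQt 1]
  obtain ⟨L, hL, hup⟩ := exists_renewal_upper hq hqs hq1 hQ0 hQ hQt hQs hr hM hw
  obtain ⟨L', hL', hlo⟩ := exists_renewal_upper (w := fun n => -w n) (M := M)
    hq hqs hq1 hQ0 hQ hQt hQs hr.neg (by simpa using hM) (fun n => by
      rw [hw n]; simp only [mul_neg, sum_neg_distrib]; ring)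
  have e1 : L = ρ / μ := by rw [eq_div_iff hμ.ne']; linarith
  have e2 : L' = -(ρ / μ) := by rw [← neg_div, eq_div_iff hμ.ne']; linarith
  rw [Metric.tendsto_nhds]
  intro ε hε
  filter_upwards [hup ε hε, hlo ε hε] with n h1 h2
  rw [Real.dist_eq, abs_lt]
  constructor <;> linarith

open Finset in
/-- Nonnegative solutions of a renewal equation with summable input are bounded. -/
lemma renewal_bounded {q r w : ℕ → ℝ} {ρ : ℝ} (hq : ∀ n, 0 ≤ q n) (hqs : HasSum q 1)
    (hq0 : q 0 < 1) (hr0 : ∀ n, 0 ≤ r n) (hr : HasSum r ρ)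
    (hw : ∀ n, w n = ∑ k ∈ range (n + 1), q k * w (n - k) + r n) (n : ℕ) :
    w n ≤ ρ / (1 - q 0) := by
  have h0 : 0 < 1 - q 0 := by linarith
  have key : ∀ n, w n ≤ (∑ k ∈ range (n + 1), r k) / (1 - q 0) := by
    intro n
    induction n using Nat.strong_induction_on with
    | _ n ih =>
      rw [le_div_iff₀ h0]
      have h1 := hw n
      rw [sum_range_succ'] at h1
      simp only [Nat.sub_zero] at h1
      set R := ∑ k ∈ range n, r k with hR
      have hR0 : 0 ≤ R := sum_nonneg fun k _ => hr0 k
      have h2 : ∑ k ∈ range n, q (k + 1) * w (n - (k + 1)) ≤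
          ∑ k ∈ range n, q (k + 1) * (R / (1 - q 0)) := by
        refine sum_le_sum fun k hk => mul_le_mul_of_nonneg_left ?_ (hq _)
        have hk := mem_range.1 hk
        refine (ih (n - (k + 1)) (by omega)).trans ?_
        exact div_le_div_of_nonneg_right (sum_le_sum_of_subset_of_nonneg
          (range_subset_range.2 (by omega)) fun i _ _ => hr0 i) h0.le
      have h3 : ∑ k ∈ range n, q (k + 1) ≤ 1 - q 0 := by
        have := sum_le_hasSum (range (n + 1)) (fun j _ => hq j) hqs
        rw [sum_range_succ'] at this
        linarith
      have h4 : (∑ k ∈ range n, q (k + 1)) * (R / (1 - q 0)) ≤ R := by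
        calc _ ≤ (1 - q 0) * (R / (1 - q 0)) :=
              mul_le_mul_of_nonneg_right h3 (by positivity)
          _ = R := by field_simp
      rw [← sum_mul] at h2
      rw [sum_range_succ]
      linarith
  refine (key n).trans ?_
  gcongr
  exact sum_le_hasSum _ (fun j _ => hr0 j) hr

/-! ### The derivative of a power series -/

/-- Derivative of a nonnegative power series inside its interval of convergence. -/
lemma hasDerivAt_powerSeries {c : ℕ → ℝ} (hc : ∀ n, 0 ≤ c n) {v x : ℝ} (hx : 0 < x) (hxv : x < v)
    (hs : Summable fun n => c n * v ^ n) :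
    Summable (fun n : ℕ => c n * (n * x ^ (n - 1))) ∧
      HasDerivAt (fun y => ∑' n, c n * y ^ n) (∑' n : ℕ, c n * (n * x ^ (n - 1))) x := by
  obtain ⟨z, hz1, hz2⟩ := exists_between hxv
  have hz : 0 < z := hx.trans hz1
  -- `n z ^ (n - 1)` is at most `v ^ n / (v - z)`, by the mean value inequality for `y ↦ y ^ n`
  have hb : ∀ n : ℕ, n * z ^ (n - 1) ≤ v ^ n / (v - z) := by
    intro n
    rw [le_div_iff₀ (by linarith)]
    have h1 : (∑ i ∈ Finset.range n, v ^ i * z ^ (n - 1 - i)) * (v - z) = v ^ n - z ^ n :=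
      (Commute.all v z).geom_sum₂_mul n
    have h2 : (n : ℝ) * z ^ (n - 1) ≤ ∑ i ∈ Finset.range n, v ^ i * z ^ (n - 1 - i) := by
      have : ∑ i ∈ Finset.range n, z ^ (n - 1) ≤ ∑ i ∈ Finset.range n, v ^ i * z ^ (n - 1 - i) := by
        refine Finset.sum_le_sum fun i hi => ?_
        have hi := Finset.mem_range.1 hi
        rw [show z ^ (n - 1) = z ^ i * z ^ (n - 1 - i) by rw [← pow_add]; congr 1; omega]
        gcongr
      simpa using this
    nlinarith [pow_pos hz n]
  have hu : Summable fun n : ℕ => c n * (n * z ^ (n - 1)) := by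
    refine Summable.of_nonneg_of_le (fun n => ?_) (fun n => ?_) (hs.mul_right (v - z)⁻¹)
    · exact mul_nonneg (hc n) (by positivity)
    · rw [mul_assoc, ← div_eq_mul_inv]
      exact mul_le_mul_of_nonneg_left (hb n) (hc n)
  have hle : ∀ (n : ℕ) (y : ℝ), y ∈ Set.Ioo 0 z →
      ‖c n * (n * y ^ (n - 1))‖ ≤ c n * (n * z ^ (n - 1)) := by
    intro n y hy
    have h0 := hy.1
    rw [Real.norm_of_nonneg (mul_nonneg (hc n) (by positivity))]
    have := hc n
    have := hy.2.le
    gcongr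
  have hmem : x ∈ Set.Ioo 0 z := ⟨hx, hz1⟩
  refine ⟨Summable.of_norm_bounded hu fun n => hle n x hmem, ?_⟩
  refine hasDerivAt_tsum_of_isPreconnected (t := Set.Ioo 0 z) hu isOpen_Ioo isPreconnected_Ioo
    (fun n y _ => (hasDerivAt_pow n y).const_mul (c n)) hle hmem ?_ hmem
  refine Summable.of_nonneg_of_le (fun n => mul_nonneg (hc n) (by positivity)) (fun n => ?_) hs
  have := hc n
  gcongr

/-! ### The size of the Galton-Watson tree -/

/-- A sum over `k`-tuples of a product over the entries is the `k`-th power of the sum. -/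
lemma tsum_pi_fin_prod {α : Type*} (g : α → ℝ≥0∞) (k : ℕ) :
    ∑' c : Fin k → α, ∏ i, g (c i) = (∑' x, g x) ^ k := by
  induction k with
  | zero => simp [tsum_fintype]
  | succ k ih =>
    rw [← (Fin.consEquiv fun _ : Fin (k + 1) => α).tsum_eq, ENNReal.tsum_prod', pow_succ', ← ih,
      ← ENNReal.tsum_mul_right]
    refine tsum_congr fun x => ?_
    rw [← ENNReal.tsum_mul_left]
    refine tsum_congr fun c => ?_
    simp [Fin.consEquiv, Fin.prod_univ_succ]

/-- A tree is its root degree together with the family of its subtrees. -/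
def planeTreeEquiv : (Σ k : ℕ, (Fin k → PlaneTree)) ≃ PlaneTree where
  toFun p := .node p.1 p.2
  invFun
    | .node k child => ⟨k, child⟩
  left_inv _ := rfl
  right_inv
    | .node _ _ => rfl

/-- The probability `PlaneTree.prob` as an element of `[0, ∞]`. -/
noncomputable def PlaneTree.eprob (a : PMF ℕ) : PlaneTree → ℝ≥0∞
  | .node k child => a k * ∏ i, (child i).eprob a

lemma PlaneTree.toReal_eprob (a : PMF ℕ) : ∀ τ : PlaneTree, (τ.eprob a).toReal = τ.prob a
  | .node k child => by
    rw [PlaneTree.eprob, PlaneTree.prob, ENNReal.toReal_mul, ENNReal.toReal_prod]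
    congr 1
    exact Finset.prod_congr rfl fun i _ => PlaneTree.toReal_eprob a (child i)

lemma PlaneTree.eprob_ne_top (a : PMF ℕ) : ∀ τ : PlaneTree, τ.eprob a ≠ ∞
  | .node k child => by
    rw [PlaneTree.eprob]
    exact ENNReal.mul_ne_top (a.apply_ne_top k)
      (ENNReal.prod_ne_top fun i _ => PlaneTree.eprob_ne_top a (child i))

lemma PlaneTree.size_pos : ∀ τ : PlaneTree, 0 < τ.size
  | .node _ _ => by rw [PlaneTree.size]; omega

/-- The law of the number of nodes of the Galton-Watson tree. -/
noncomputable def treeCoeff (a : PMF ℕ) (n : ℕ) : ℝ≥0∞ :=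
  ∑' τ : PlaneTree, if τ.size = n then τ.eprob a else 0

lemma egf_treeCoeff (a : PMF ℕ) (u : ℝ≥0∞) :
    egf (treeCoeff a) u = ∑' τ : PlaneTree, τ.eprob a * u ^ τ.size := by
  simp only [egf, treeCoeff, ← ENNReal.tsum_mul_right]
  rw [ENNReal.tsum_comm]
  refine tsum_congr fun τ => ?_
  rw [tsum_eq_single τ.size]
  · simp
  · intro n hn
    simp [hn.symm]

/-- The branching equation `T(u) = u A(T(u))`, by decomposition at the root. -/
lemma egf_treeCoeff_eq (a : PMF ℕ) (u : ℝ≥0∞) :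
    egf (treeCoeff a) u = u * egf a (egf (treeCoeff a) u) := by
  conv_rhs => rw [egf]
  rw [← ENNReal.tsum_mul_left]
  simp only [egf_treeCoeff, ← tsum_pi_fin_prod]
  rw [← planeTreeEquiv.tsum_eq (fun τ : PlaneTree => τ.eprob a * u ^ τ.size), ENNReal.tsum_sigma']
  refine tsum_congr fun k => ?_
  rw [← ENNReal.tsum_mul_left, ← ENNReal.tsum_mul_left]
  refine tsum_congr fun c => ?_
  simp only [planeTreeEquiv, Equiv.coe_fn_mk, PlaneTree.eprob, PlaneTree.size, pow_add, pow_one,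
    Finset.prod_mul_distrib, Finset.prod_pow_eq_pow_sum]
  ring

/-- The probabilities of all finite trees sum to at most one. -/
lemma tsum_treeCoeff_le_one (a : PMF ℕ) : ∑' n, treeCoeff a n ≤ 1 := by
  have key : ∀ N : ℕ, ∑' τ : PlaneTree, (if τ.size ≤ N then τ.eprob a else 0) ≤ 1 := by
    intro N
    induction N with
    | zero => simp [fun τ : PlaneTree => (PlaneTree.size_pos τ).ne']
    | succ N ih =>
      rw [← planeTreeEquiv.tsum_eq, ENNReal.tsum_sigma']
      calc _ ≤ ∑' k : ℕ, a k * (∑' τ : PlaneTree, if τ.size ≤ N then τ.eprob a else 0) ^ k := by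
            refine ENNReal.tsum_le_tsum fun k => ?_
            rw [← tsum_pi_fin_prod, ← ENNReal.tsum_mul_left]
            refine ENNReal.tsum_le_tsum fun c => ?_
            simp only [planeTreeEquiv, Equiv.coe_fn_mk, PlaneTree.eprob, PlaneTree.size]
            split_ifs with h
            · refine le_of_eq ?_
              congr 1
              refine Finset.prod_congr rfl fun i _ => (if_pos ?_).symm
              have := Finset.single_le_sum (f := fun i => (c i).size) (fun j _ => Nat.zero_le _)
                (Finset.mem_univ i)
              omega
            · exact zero_le
        _ ≤ ∑' k : ℕ, a k * 1 := ENNReal.tsum_le_tsum fun k => by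
            gcongr
            exact pow_le_one₀ (zero_le) ih
        _ = 1 := by simp [a.tsum_coe]
  rw [← egf_one, egf_treeCoeff]
  simp only [one_pow, mul_one]
  rw [ENNReal.tsum_eq_iSup_sum]
  refine iSup_le fun s => ?_
  refine le_trans ?_ (key (s.sup PlaneTree.size))
  refine le_trans (le_of_eq ?_) (ENNReal.sum_le_tsum s)
  exact Finset.sum_congr rfl fun τ hτ => (if_pos (Finset.le_sup (f := PlaneTree.size) hτ)).symm

lemma genFun_eq (b : PMF ℕ) {v : ℝ} (hv : 0 ≤ v) :
    genFun b v = (egf b (ENNReal.ofReal v)).toReal := by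
  rw [genFun, egf, ENNReal.tsum_toReal_eq]
  · refine tsum_congr fun n => ?_
    rw [ENNReal.toReal_mul, ENNReal.toReal_pow, ENNReal.toReal_ofReal hv]
  · exact fun n => ENNReal.mul_ne_top (b.apply_ne_top n) (by simp)

lemma treeGenFun_eq (a : PMF ℕ) {u : ℝ} (hu : 0 ≤ u) :
    treeGenFun a u = (egf (treeCoeff a) (ENNReal.ofReal u)).toReal := by
  rw [treeGenFun, egf_treeCoeff, ENNReal.tsum_toReal_eq]
  · refine tsum_congr fun τ => ?_
    rw [ENNReal.toReal_mul, ENNReal.toReal_pow, ENNReal.toReal_ofReal hu, PlaneTree.toReal_eprob]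
  · exact fun τ => ENNReal.mul_ne_top (τ.eprob_ne_top a) (by simp)

lemma treeGenFun_zero (a : PMF ℕ) : treeGenFun a 0 = 0 := by
  simp [treeGenFun, fun τ : PlaneTree => (PlaneTree.size_pos τ).ne']

/-- Since the generating functions are infinite outside their domain and the junk value there
is `0`, a nonzero value of `T_A ∘ B` is a genuine one. -/
lemma finite_of_treeGenFun_ne_zero {a b : PMF ℕ} {v : ℝ} (hv : 0 ≤ v)
    (h : treeGenFun a (genFun b v) ≠ 0) :
    egf b (ENNReal.ofReal v) ≠ ∞ ∧
      egf (treeCoeff a) (egf b (ENNReal.ofReal v)) ≠ ∞ ∧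
      treeGenFun a (genFun b v) =
        (egf (treeCoeff a) (egf b (ENNReal.ofReal v))).toReal := by
  have hB : egf b (ENNReal.ofReal v) ≠ ∞ := by
    intro hB
    rw [genFun_eq b hv, hB, ENNReal.toReal_top, treeGenFun_zero] at h
    exact h rfl
  have hT : treeGenFun a (genFun b v) =
        (egf (treeCoeff a) (egf b (ENNReal.ofReal v))).toReal := by
    rw [genFun_eq b hv, treeGenFun_eq a ENNReal.toReal_nonneg, ENNReal.ofReal_toReal hB]
  refine ⟨hB, fun ht => h ?_, hT⟩
  rw [hT, ht, ENNReal.toReal_top]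

/-! ### Subcritical trees -/

lemma egf_tail_one_eq_mean {c : PMF ℕ} {l : ℝ}
    (h : HasSum (fun n : ℕ => (n : ℝ) * (c n).toReal) l) :
    egf (tail c) 1 = ENNReal.ofReal l := by
  rw [egf_tail_one, ← h.tsum_eq, ENNReal.ofReal_tsum_of_nonneg _ h.summable]
  · refine tsum_congr fun n => ?_
    rw [ENNReal.ofReal_mul (by positivity), ENNReal.ofReal_toReal (c.apply_ne_top n),
      ENNReal.ofReal_natCast]
  · intro n; positivity

lemma pmf_zero_ne_zero {c : PMF ℕ} (h : egf (tail c) 1 < 1) : c 0 ≠ 0 := by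
  intro h0
  have h1 := tail_zero_add c
  rw [h0, zero_add, c.tsum_coe] at h1
  have h2 : tail c 0 ≤ egf (tail c) 1 := by
    rw [egf_succ]; exact le_self_add
  rw [h1] at h2
  exact absurd h (not_lt.2 h2)

/-- A subcritical Galton-Watson tree is almost surely finite. -/
lemma tsum_treeCoeff (a : PMF ℕ) (ha : egf (tail a) 1 < 1) : ∑' n, treeCoeff a n = 1 := by
  set t := ∑' n, treeCoeff a n with ht
  have ht1 : t ≤ 1 := tsum_treeCoeff_le_one a
  have e1 : t = egf a t := by
    have := egf_treeCoeff_eq a 1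
    rwa [egf_one, one_mul] at this
  have e2 := egf_add_egf_tail a t
  rw [a.tsum_coe, ← e1] at e2
  -- with `τ = tail(A)(t) < 1` the equation reads `(1 - t) (1 - τ) = 0`
  set τ := egf (tail a) t
  have hτ : τ < 1 := (egf_mono _ ht1).trans_lt ha
  have htop : t ≠ ∞ := ne_top_of_le_ne_top ENNReal.one_ne_top ht1
  have e3 : t.toReal + τ.toReal = 1 + t.toReal * τ.toReal := by
    have := congrArg ENNReal.toReal e2
    rwa [ENNReal.toReal_add htop hτ.ne_top, ENNReal.toReal_add ENNReal.one_ne_top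
      (ENNReal.mul_ne_top htop hτ.ne_top), ENNReal.toReal_mul, ENNReal.toReal_one] at this
  have h4 : τ.toReal < 1 := by
    rw [← ENNReal.toReal_one]
    exact (ENNReal.toReal_lt_toReal hτ.ne_top ENNReal.one_ne_top).2 hτ
  have h5 : (1 - t.toReal) * (1 - τ.toReal) = 0 := by linear_combination -e3
  rcases mul_eq_zero.1 h5 with h | h
  · rw [← ENNReal.ofReal_toReal htop, show t.toReal = 1 by linarith, ENNReal.ofReal_one]
  · linarith

/-! ### The Markov chain: monotonicity, limit law and uniqueness -/

/-- Expectation of a nonnegative function under a discrete law. -/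
noncomputable def expect {α : Type*} (p : PMF α) (h : α → ℝ≥0∞) : ℝ≥0∞ := ∑' s, p s * h s

lemma expect_pure {α : Type*} (x : α) (h : α → ℝ≥0∞) : expect (PMF.pure x) h = h x := by
  rw [expect, tsum_eq_single x]
  · simp
  · intro y hy; simp [hy]

lemma expect_bind {α β : Type*} (p : PMF α) (f : α → PMF β) (h : β → ℝ≥0∞) :
    expect (p.bind f) h = expect p fun s => expect (f s) h := by
  simp only [expect, PMF.bind_apply, ← ENNReal.tsum_mul_right, ← ENNReal.tsum_mul_left]
  rw [ENNReal.tsum_comm]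
  simp only [mul_assoc]

lemma expect_map {α β : Type*} (p : PMF α) (f : α → β) (h : β → ℝ≥0∞) :
    expect (p.map f) h = expect p fun s => h (f s) := by
  rw [PMF.map, expect_bind]
  simp only [Function.comp, expect_pure]

lemma expect_mono {α : Type*} (p : PMF α) {h g : α → ℝ≥0∞} (hg : ∀ s, h s ≤ g s) :
    expect p h ≤ expect p g := ENNReal.tsum_le_tsum fun s => by gcongr; exact hg s

lemma expect_add {α : Type*} (p : PMF α) (h g : α → ℝ≥0∞) :
    expect p (fun s => h s + g s) = expect p h + expect p g := by
  simp only [expect, mul_add, ENNReal.tsum_add]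

lemma expect_const {α : Type*} (p : PMF α) (r : ℝ≥0∞) : expect p (fun _ => r) = r := by
  simp [expect, ENNReal.tsum_mul_right, p.tsum_coe]

lemma expect_mul_left {α : Type*} (p : PMF α) (r : ℝ≥0∞) (h : α → ℝ≥0∞) :
    expect p (fun s => r * h s) = r * expect p h := by
  simp only [expect, ← ENNReal.tsum_mul_left]
  exact tsum_congr fun s => by ring

lemma expect_mul_right {α : Type*} (p : PMF α) (r : ℝ≥0∞) (h : α → ℝ≥0∞) :
    expect p (fun s => h s * r) = expect p h * r := by
  simp only [expect, ← ENNReal.tsum_mul_right, mul_assoc]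

lemma expect_single {α : Type*} [DecidableEq α] (p : PMF α) (x : α) :
    expect p (fun s => if s = x then 1 else 0) = p x := by
  rw [expect, tsum_eq_single x]
  · simp
  · intro y hy; simp [hy]

lemma expect_transition (a b : PMF ℕ) (s : ℕ × ℕ) (h : ℕ × ℕ → ℝ≥0∞) :
    expect (transition a b s) h = expect a fun i => expect b fun j => h (step s i j) := by
  simp only [transition, expect_bind, expect_map]

/-- The law of the chain at time `t`, started from the empty network. -/
noncomputable def law (a b : PMF ℕ) : ℕ → PMF (ℕ × ℕ)
  | 0 => PMF.pure (0, 0)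
  | t + 1 => (law a b t).bind (transition a b)

lemma law_zero (a b : PMF ℕ) : law a b 0 = PMF.pure (0, 0) := rfl

lemma law_succ (a b : PMF ℕ) (t : ℕ) : law a b (t + 1) = (law a b t).bind (transition a b) := rfl

lemma expect_law_succ (a b : PMF ℕ) (t : ℕ) (h : ℕ × ℕ → ℝ≥0∞) :
    expect (law a b (t + 1)) h = expect (law a b t) fun s => expect (transition a b s) h :=
  expect_bind _ _ _

lemma step_mono {s s' : ℕ × ℕ} (h : s ≤ s') (i j : ℕ) : step s i j ≤ step s' i j := by
  obtain ⟨h1, h2⟩ := h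
  refine ⟨?_, ?_⟩
  · simp only [step]; omega
  · simp only [step]; split_ifs <;> omega

lemma expect_transition_antitone (a b : PMF ℕ) {h : ℕ × ℕ → ℝ≥0∞} (hh : Antitone h) :
    Antitone fun s => expect (transition a b s) h := fun s s' hs => by
  simp only [expect_transition]
  exact expect_mono _ fun i => expect_mono _ fun j => hh (step_mono hs i j)

lemma expect_transition_monotone (a b : PMF ℕ) {h : ℕ × ℕ → ℝ≥0∞} (hh : Monotone h) :
    Monotone fun s => expect (transition a b s) h := fun s s' hs => by
  simp only [expect_transition]
  exact expect_mono _ fun i => expect_mono _ fun j => hh (step_mono hs i j)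

lemma zero_le_state (s : ℕ × ℕ) : ((0, 0) : ℕ × ℕ) ≤ s := ⟨Nat.zero_le _, Nat.zero_le _⟩

/-- Started from the minimal state, the chain is stochastically increasing. -/
lemma expect_law_succ_le (a b : PMF ℕ) (t : ℕ) {h : ℕ × ℕ → ℝ≥0∞} (hh : Antitone h) :
    expect (law a b (t + 1)) h ≤ expect (law a b t) h := by
  induction t generalizing h with
  | zero =>
    rw [law_succ, law_zero, expect_bind, expect_pure, expect_pure]
    calc _ ≤ expect (transition a b (0, 0)) fun _ => h (0, 0) :=
          expect_mono _ fun s => hh (zero_le_state s)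
      _ = _ := expect_const _ _
  | succ t ih =>
    rw [expect_law_succ a b (t + 1) h, expect_law_succ a b t h]
    exact ih (expect_transition_antitone a b hh)

lemma le_expect_law_succ (a b : PMF ℕ) (t : ℕ) {h : ℕ × ℕ → ℝ≥0∞} (hh : Monotone h) :
    expect (law a b t) h ≤ expect (law a b (t + 1)) h := by
  induction t generalizing h with
  | zero =>
    rw [law_succ, law_zero, expect_bind, expect_pure, expect_pure]
    calc _ = expect (transition a b (0, 0)) fun _ => h (0, 0) := (expect_const _ _).symm
      _ ≤ _ := expect_mono _ fun s => hh (zero_le_state s)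
  | succ t ih =>
    rw [expect_law_succ a b (t + 1) h, expect_law_succ a b t h]
    exact ih (expect_transition_monotone a b hh)

/-- The chain started from the minimal state is dominated by every stationary law. -/
lemma expect_stationary_le (a b : PMF ℕ) {π : PMF (ℕ × ℕ)} (hπ : IsStationary a b π) (t : ℕ)
    {h : ℕ × ℕ → ℝ≥0∞} (hh : Antitone h) : expect π h ≤ expect (law a b t) h := by
  induction t generalizing h with
  | zero =>
    rw [law_zero, expect_pure]
    calc _ ≤ expect π fun _ => h (0, 0) := expect_mono _ fun s => hh (zero_le_state s)
      _ = _ := expect_const _ _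
  | succ t ih =>
    rw [law_succ, expect_bind]
    conv_lhs => rw [← hπ, expect_bind]
    exact ih (expect_transition_antitone a b hh)

lemma antitone_indicator {D : Set (ℕ × ℕ)} (hD : IsLowerSet D) :
    Antitone (D.indicator (fun _ => (1 : ℝ≥0∞))) := fun s s' hs => by
  by_cases h : s' ∈ D
  · simp [h, hD hs h]
  · simp [h]

/-- Pointwise convergence of the laws: a singleton is the difference of two lower sets, whose
probabilities decrease with time. -/
lemma exists_tendsto_law (a b : PMF ℕ) (s : ℕ × ℕ) :
    ∃ l, Tendsto (fun t => law a b t s) atTop (𝓝 l) := by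
  have conv : ∀ D : Set (ℕ × ℕ), IsLowerSet D →
      ∃ l, l ≠ ∞ ∧ Tendsto (fun t => expect (law a b t) (D.indicator fun _ => 1)) atTop
        (𝓝 l) := fun D hD => by
    refine ⟨_, ?_, tendsto_atTop_iInf
      (antitone_nat_of_succ_le fun t => expect_law_succ_le a b t (antitone_indicator hD))⟩
    refine ne_top_of_le_ne_top ENNReal.one_ne_top ((iInf_le _ 0).trans ?_)
    rw [law_zero, expect_pure]
    exact Set.indicator_le_self' (fun _ _ => zero_le) _
  obtain ⟨l1, h1, t1⟩ := conv (Set.Iic s) (isLowerSet_Iic s)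
  obtain ⟨l2, h2, t2⟩ := conv (Set.Iio s) (isLowerSet_Iio s)
  refine ⟨l1 - l2, (ENNReal.Tendsto.sub t1 t2 (Or.inl h1)).congr fun t => ?_⟩
  have e : (expect (law a b t) ((Set.Iic s).indicator fun _ => 1)) =
      law a b t s + expect (law a b t) ((Set.Iio s).indicator fun _ => 1) := by
    rw [← expect_single (law a b t) s, ← expect_add]
    congr 1
    funext x
    rcases eq_or_ne x s with rfl | hx
    · simp
    · simp only [Set.indicator, Set.mem_Iic, Set.mem_Iio, hx, if_false, zero_add,
        lt_iff_le_and_ne, ne_eq, not_false_eq_true, and_true]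
  rw [e]
  refine ENNReal.add_sub_cancel_right (ne_top_of_le_ne_top ENNReal.one_ne_top ?_)
  conv_rhs => rw [← expect_const (law a b t) 1]
  exact expect_mono _ fun x => Set.indicator_le_self' (fun _ _ => zero_le) _

/-- Whenever the second queue is empty, the first one holds only the arrivals of the last time
slot, which are independent of that event. -/
lemma expect_transition_snd_zero (a b : PMF ℕ) (s : ℕ × ℕ) (x : ℝ≥0∞) :
    expect (transition a b s) (fun z => if z.2 = 0 then x ^ z.1 else 0) =
      egf a x * expect (transition a b s) (fun z => if z.2 = 0 then 1 else 0) := by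
  simp only [expect_transition]
  have h1 : ∀ i j, (if (step s i j).2 = 0 then x ^ (step s i j).1 else 0 : ℝ≥0∞) =
      x ^ i * if (step s 0 j).2 = 0 then 1 else 0 := by
    intro i j
    simp only [step]
    rcases Nat.eq_zero_or_pos s.1 with h | h
    · simp [h]
    · simp [h]
  have h2 : ∀ i j, (if (step s i j).2 = 0 then 1 else 0 : ℝ≥0∞) =
      if (step s 0 j).2 = 0 then 1 else 0 := fun i j => rfl
  simp only [h1, h2, expect_mul_left, expect_mul_right, expect_const]
  rfl

lemma expect_snd_zero_of_bind (a b : PMF ℕ) (p : PMF (ℕ × ℕ)) (x : ℝ≥0∞) :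
    expect (p.bind (transition a b)) (fun z => if z.2 = 0 then x ^ z.1 else 0) =
      egf a x * expect (p.bind (transition a b)) (fun z => if z.2 = 0 then 1 else 0) := by
  simp only [expect_bind, expect_transition_snd_zero, expect_mul_left]

lemma zero_eq_expect (p : PMF (ℕ × ℕ)) :
    p (0, 0) = expect p (fun z => if z.2 = 0 then 0 ^ z.1 else 0) := by
  rw [← expect_single p (0, 0)]
  congr 1
  funext z
  rcases Nat.eq_zero_or_pos z.2 with h | h
  · rcases Nat.eq_zero_or_pos z.1 with h' | h'
    · simp [Prod.ext_iff, h, h']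
    · simp [Prod.ext_iff, h, h'.ne']
  · simp [Prod.ext_iff, h.ne']

/-- The law of the chain charges `(0, 0)` by a product, by `expect_snd_zero_of_bind` at `0`. -/
lemma bind_apply_zero (a b : PMF ℕ) (p : PMF (ℕ × ℕ)) :
    (p.bind (transition a b)) (0, 0) =
      a 0 * expect (p.bind (transition a b)) (fun z => if z.2 = 0 then 1 else 0) := by
  rw [zero_eq_expect, expect_snd_zero_of_bind, egf_zero]

lemma mean_eq (c : PMF ℕ) : expect c (fun n => (n : ℝ≥0∞)) = egf (tail c) 1 := by
  rw [egf_tail_one, expect]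
  exact tsum_congr fun n => mul_comm _ _

lemma expect_transition_fst (a b : PMF ℕ) (s : ℕ × ℕ) :
    expect (transition a b s) (fun z => (z.1 : ℝ≥0∞)) + (if 0 < s.1 then 1 else 0) =
      s.1 + egf (tail a) 1 := by
  rw [expect_transition]
  simp only [step, Nat.cast_add, expect_const, expect_add, mean_eq]
  rcases Nat.eq_zero_or_pos s.1 with h | h
  · simp [h]
  · have : ((s.1 - 1 : ℕ) : ℝ≥0∞) + 1 = s.1 := by
      exact_mod_cast Nat.sub_add_cancel h
    rw [if_pos h, ← this]
    ring

lemma expect_transition_snd (a b : PMF ℕ) (s : ℕ × ℕ) :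
    expect (transition a b s) (fun z => (z.2 : ℝ≥0∞)) + (if 0 < s.2 then 1 else 0) =
      s.2 + egf (tail b) 1 + (if 0 < s.1 then 1 else 0) := by
  rw [expect_transition]
  simp only [step, Nat.cast_add, expect_const, expect_add, mean_eq, Nat.cast_ite, Nat.cast_one,
    Nat.cast_zero]
  rcases Nat.eq_zero_or_pos s.2 with h | h
  · simp [h]
  · have : ((s.2 - 1 : ℕ) : ℝ≥0∞) + 1 = s.2 := by
      exact_mod_cast Nat.sub_add_cancel h
    rw [if_pos h, ← this]
    ring

/-- The busy probabilities are at most the offered loads: the means are finite and increase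
with time, so the mean departures do not exceed the mean arrivals. -/
lemma busy_le (a b : PMF ℕ) (ha : egf (tail a) 1 ≠ ∞) (hb : egf (tail b) 1 ≠ ∞) (t : ℕ) :
    expect (law a b t) (fun z => if 0 < z.2 then 1 else 0) ≤ egf (tail a) 1 + egf (tail b) 1 := by
  have m1 : Monotone fun z : ℕ × ℕ => (z.1 : ℝ≥0∞) := fun z z' h => by
    simpa using h.1
  have m2 : Monotone fun z : ℕ × ℕ => (z.2 : ℝ≥0∞) := fun z z' h => by
    simpa using h.2
  have bal1 : ∀ t, expect (law a b (t + 1)) (fun z => (z.1 : ℝ≥0∞)) +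
      expect (law a b t) (fun z => if 0 < z.1 then 1 else 0) =
      expect (law a b t) (fun z => (z.1 : ℝ≥0∞)) + egf (tail a) 1 := fun t => by
    rw [law_succ, expect_bind, ← expect_add]
    simp only [expect_transition_fst]
    rw [expect_add, expect_const]
  have bal2 : ∀ t, expect (law a b (t + 1)) (fun z => (z.2 : ℝ≥0∞)) +
      expect (law a b t) (fun z => if 0 < z.2 then 1 else 0) =
      expect (law a b t) (fun z => (z.2 : ℝ≥0∞)) + egf (tail b) 1 +
        expect (law a b t) (fun z => if 0 < z.1 then 1 else 0) := fun t => by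
    rw [law_succ, expect_bind, ← expect_add]
    simp only [expect_transition_snd]
    rw [expect_add, expect_add, expect_const]
  have ind_le : ∀ t, expect (law a b t) (fun z => if 0 < z.1 then 1 else 0) ≤ 1 := fun t => by
    conv_rhs => rw [← expect_const (law a b t) 1]
    exact expect_mono _ fun x => by split_ifs <;> simp
  have fin1 : ∀ t, expect (law a b t) (fun z => (z.1 : ℝ≥0∞)) ≠ ∞ := fun t => by
    induction t with
    | zero => rw [law_zero, expect_pure]; simp
    | succ t ih =>
      refine ne_top_of_le_ne_top (ENNReal.add_ne_top.2 ⟨ih, ha⟩) ?_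
      rw [← bal1 t]; exact le_self_add
  have fin2 : ∀ t, expect (law a b t) (fun z => (z.2 : ℝ≥0∞)) ≠ ∞ := fun t => by
    induction t with
    | zero => rw [law_zero, expect_pure]; simp
    | succ t ih =>
      refine ne_top_of_le_ne_top (ENNReal.add_ne_top.2 ⟨ENNReal.add_ne_top.2 ⟨ih, hb⟩,
        ne_top_of_le_ne_top ENNReal.one_ne_top (ind_le t)⟩) ?_
      rw [← bal2 t]; exact le_self_add
  have b1 : expect (law a b t) (fun z => if 0 < z.1 then 1 else 0) ≤ egf (tail a) 1 := by
    refine (ENNReal.add_le_add_iff_left (fin1 t)).1 ?_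
    rw [← bal1 t]
    gcongr
    exact le_expect_law_succ a b t m1
  refine (ENNReal.add_le_add_iff_left (fin2 t)).1 ?_
  calc _ ≤ expect (law a b (t + 1)) (fun z => (z.2 : ℝ≥0∞)) +
      expect (law a b t) (fun z => if 0 < z.2 then 1 else 0) := by
        gcongr
        exact le_expect_law_succ a b t m2
    _ = _ := bal2 t
    _ ≤ expect (law a b t) (fun z => (z.2 : ℝ≥0∞)) + egf (tail b) 1 + egf (tail a) 1 := by gcongr
    _ = _ := by ring

lemma le_law_zero (a b : PMF ℕ) (ha : egf (tail a) 1 ≠ ∞) (hb : egf (tail b) 1 ≠ ∞) (t : ℕ) :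
    a 0 * (1 - (egf (tail a) 1 + egf (tail b) 1)) ≤ law a b (t + 1) (0, 0) := by
  rw [law_succ, bind_apply_zero]
  gcongr
  rw [tsub_le_iff_left]
  have h := busy_le a b ha hb (t + 1)
  have e : (1 : ℝ≥0∞) = expect (law a b (t + 1)) (fun z => if 0 < z.2 then 1 else 0) +
      expect (law a b (t + 1)) (fun z => if z.2 = 0 then 1 else 0) := by
    rw [← expect_add]
    conv_lhs => rw [← expect_const (law a b (t + 1)) 1]
    congr 1
    funext z
    rcases Nat.eq_zero_or_pos z.2 with h | h
    · simp [h]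
    · simp [h, h.ne']
  calc (1 : ℝ≥0∞) = _ := e
    _ ≤ _ := by gcongr; exact le_refl _

lemma eq_of_le_of_tsum_le {α : Type*} {f g : α → ℝ≥0∞} (h : ∀ s, f s ≤ g s)
    (hs : ∑' s, g s ≤ ∑' s, f s) (hf : ∑' s, f s ≠ ∞) : f = g := by
  funext s
  by_contra hne
  exact absurd hs (not_le.2 (ENNReal.tsum_lt_tsum hf h (lt_of_le_of_ne (h s) hne)))

lemma tsum_tsum_transition (a b : PMF ℕ) (f : ℕ × ℕ → ℝ≥0∞) :
    ∑' s', ∑' s, f s * transition a b s s' = ∑' s, f s := by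
  rw [ENNReal.tsum_comm]
  simp only [ENNReal.tsum_mul_left, PMF.tsum_coe, mul_one]

/-- The chain can move from every state to `(0, 0)`, by successive slots without arrivals: an
invariant measure which does not charge `(0, 0)` is zero. -/
lemma invariant_eq_zero (a b : PMF ℕ) (ha : a 0 ≠ 0) (hb : b 0 ≠ 0) {d : ℕ × ℕ → ℝ≥0∞}
    (hd : ∀ s', ∑' s, d s * transition a b s s' = d s') (h0 : d (0, 0) = 0) (s : ℕ × ℕ) :
    d s = 0 := by
  have pull : ∀ s, d (step s 0 0) = 0 → d s = 0 := fun s hs => by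
    rw [← hd, ENNReal.tsum_eq_zero] at hs
    refine (mul_eq_zero.1 (hs s)).resolve_right ?_
    rw [← expect_single (transition a b s), expect_transition]
    intro h
    have h1 := ENNReal.tsum_eq_zero.1 h 0
    have h2 := ENNReal.tsum_eq_zero.1 ((mul_eq_zero.1 h1).resolve_left ha) 0
    simp [hb] at h2
  -- without arrivals `2 x + y` decreases
  have key : ∀ n, ∀ s : ℕ × ℕ, 2 * s.1 + s.2 = n → d s = 0 := fun n => by
    induction n using Nat.strong_induction_on with
    | _ n ih =>
      intro s hs
      rcases Nat.eq_zero_or_pos n with hn | hn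
      · have : s = (0, 0) := Prod.ext (by simp; omega) (by simp; omega)
        rw [this, h0]
      · refine pull s (ih _ ?_ _ rfl)
        simp only [step]
        split_ifs <;> omega
  exact key _ s rfl

lemma stationary_unique (a b : PMF ℕ) (ha : a 0 ≠ 0) (hb : b 0 ≠ 0) {p q : PMF (ℕ × ℕ)}
    (hp : IsStationary a b p) (hq : IsStationary a b q) : p = q := by
  -- the minimum of two invariant laws is invariant, hence so are the differences to it
  set e : ℕ × ℕ → ℝ≥0∞ := fun s => min (p s) (q s) with he
  have efin : ∑' s, e s ≠ ∞ := ne_top_of_le_ne_top (p.tsum_coe ▸ ENNReal.one_ne_top)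
    (ENNReal.tsum_le_tsum fun s => min_le_left _ _)
  have inv : ∀ {p : PMF (ℕ × ℕ)}, IsStationary a b p →
      ∀ s', ∑' s, p s * transition a b s s' = p s' := fun hp s' => by
    rw [← PMF.bind_apply, hp]
  have einv : (fun s' => ∑' s, e s * transition a b s s') = e := by
    refine eq_of_le_of_tsum_le (fun s' => le_min ?_ ?_) ?_ ?_
    · rw [← inv hp s']
      exact ENNReal.tsum_le_tsum fun s => by gcongr; exact min_le_left _ _
    · rw [← inv hq s']
      exact ENNReal.tsum_le_tsum fun s => by gcongr; exact min_le_right _ _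
    · rw [tsum_tsum_transition]
    · rwa [tsum_tsum_transition]
  have main : ∀ {p : PMF (ℕ × ℕ)}, IsStationary a b p → (∀ s, e s ≤ p s) →
      e (0, 0) = p (0, 0) → ∀ s, p s = e s := fun {p} hp hle h0 s => by
    have hd : ∀ s', ∑' s, (p s - e s) * transition a b s s' = p s' - e s' := fun s' => by
      have h1 : ∑' s, (p s - e s) * transition a b s s' + e s' = p s' := by
        rw [← congrFun einv s', ← ENNReal.tsum_add, ← inv hp s']
        refine tsum_congr fun s => ?_
        rw [← add_mul, tsub_add_cancel_of_le (hle s)]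
      rw [← h1, ENNReal.add_sub_cancel_right
        (ne_top_of_le_ne_top (p.apply_ne_top s') (hle s'))]
    have := invariant_eq_zero a b ha hb (d := fun s => p s - e s) hd (by simp [h0]) s
    exact le_antisymm (tsub_eq_zero_iff_le.1 this) (hle s)
  have tot : ∀ {p q : PMF (ℕ × ℕ)}, (∀ s, p s ≤ q s) → p = q := fun {p q} h =>
    PMF.ext fun s => congrFun (eq_of_le_of_tsum_le h (by rw [p.tsum_coe, q.tsum_coe])
      (p.tsum_coe ▸ ENNReal.one_ne_top)) s
  rcases le_total (p (0, 0)) (q (0, 0)) with h | h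
  · exact tot fun s => (main hp (fun s => min_le_left _ _) (min_eq_left h) s).le.trans
      (min_le_right _ _)
  · exact (tot fun s => (main hq (fun s => min_le_right _ _) (min_eq_right h) s).le.trans
      (min_le_left _ _)).symm

/-- Existence of the stationary law as the pointwise limit of the laws from the empty state. -/
lemma exists_stationary (a b : PMF ℕ) (hab : egf (tail a) 1 + egf (tail b) 1 < 1)
    (ha0 : a 0 ≠ 0) :
    ∃ π : PMF (ℕ × ℕ), IsStationary a b π ∧
      ∀ s, Tendsto (fun t => law a b t s) atTop (𝓝 (π s)) := by
  choose l hl using exists_tendsto_law a b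
  have ha : egf (tail a) 1 ≠ ∞ := (ENNReal.add_ne_top.1 hab.ne_top).1
  have hb : egf (tail b) 1 ≠ ∞ := (ENNReal.add_ne_top.1 hab.ne_top).2
  have l0 : l (0, 0) ≠ 0 := by
    have : a 0 * (1 - (egf (tail a) 1 + egf (tail b) 1)) ≤ l (0, 0) :=
      ge_of_tendsto ((hl (0, 0)).comp (tendsto_add_atTop_nat 1))
        (Eventually.of_forall fun t => le_law_zero a b ha hb t)
    exact ((ENNReal.mul_pos ha0 (tsub_pos_of_lt hab).ne').trans_le this).ne'
  have lsum : ∑' s, l s ≤ 1 := by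
    rw [ENNReal.tsum_eq_iSup_sum]
    refine iSup_le fun F => le_of_tendsto (tendsto_finsetSum F fun s _ => hl s)
      (Eventually.of_forall fun t => ?_)
    rw [← (law a b t).tsum_coe]
    exact ENNReal.sum_le_tsum F
  have lfin : ∑' s, l s ≠ ∞ := ne_top_of_le_ne_top ENNReal.one_ne_top lsum
  have linv : (fun s' => ∑' s, l s * transition a b s s') = l := by
    refine eq_of_le_of_tsum_le (fun s' => ?_) ?_ ?_
    · rw [ENNReal.tsum_eq_iSup_sum]
      refine iSup_le fun F => ?_
      refine le_of_tendsto_of_tendsto (tendsto_finsetSum F fun s _ =>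
        ENNReal.Tendsto.mul_const (hl s) (Or.inr ((transition a b s).apply_ne_top s')))
        ((hl s').comp (tendsto_add_atTop_nat 1)) (Eventually.of_forall fun t => ?_)
      simp only [Function.comp, law, PMF.bind_apply]
      exact ENNReal.sum_le_tsum F
    · rw [tsum_tsum_transition]
    · rwa [tsum_tsum_transition]
  have lsum0 : ∑' s, l s ≠ 0 := fun h => l0 (ENNReal.tsum_eq_zero.1 h _)
  set π := PMF.normalize l lsum0 lfin
  have hπ : IsStationary a b π := by
    refine PMF.ext fun s' => ?_
    rw [PMF.bind_apply, PMF.normalize_apply]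
    conv_rhs => rw [← congrFun linv s']
    simp only [π, PMF.normalize_apply, ← ENNReal.tsum_mul_right]
    exact tsum_congr fun s => by ring
  -- no mass is lost in the limit, since the chain is dominated by the normalized limit
  have mass : ∑' s, l s = 1 := by
    refine le_antisymm lsum ?_
    have h1 : π (0, 0) ≤ l (0, 0) := by
      refine ge_of_tendsto (hl (0, 0)) (Eventually.of_forall fun t => ?_)
      rw [← expect_single π, ← expect_single (law a b t)]
      refine expect_stationary_le a b hπ t fun s s' hs => ?_
      by_cases h : s' = (0, 0)
      · have : s = (0, 0) := le_antisymm (h ▸ hs) (zero_le_state s)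
        simp [h, this]
      · simp [h]
    have lt0 : l (0, 0) ≠ ∞ := ENNReal.ne_top_of_tsum_ne_top lfin _
    rw [PMF.normalize_apply, ← div_eq_mul_inv,
      ENNReal.div_le_iff lsum0 lfin] at h1
    by_contra hlt
    rw [not_le] at hlt
    have := ENNReal.mul_lt_mul_right l0 lt0 hlt
    rw [mul_one] at this
    exact absurd h1 (not_le.2 this)
  refine ⟨π, hπ, fun s => ?_⟩
  rw [PMF.normalize_apply, mass, inv_one, mul_one]
  exact hl s

/-! ### The law of the occupancies -/

lemma occupancy_congr {Ω Ω' : Type*} {A B : ℕ → Ω → ℕ} {A' B' : ℕ → Ω' → ℕ} {ω : Ω} {ω' : Ω'}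
    (t : ℕ) (hA : ∀ s < t, A s ω = A' s ω') (hB : ∀ s < t, B s ω = B' s ω') :
    occupancy A B t ω = occupancy A' B' t ω' := by
  induction t with
  | zero => rfl
  | succ t ih =>
    rw [occupancy, occupancy, ih (fun s hs => hA s (by omega)) (fun s hs => hB s (by omega)),
      hA t (by omega), hB t (by omega)]

lemma iIndepFun_bool {Ω : Type*} [MeasurableSpace Ω] {P : Measure Ω} [IsProbabilityMeasure P]
    {β : Type*} [MeasurableSpace β] {X : Bool → Ω → β} (h : IndepFun (X true) (X false) P) :
    iIndepFun X P := by
  rw [iIndepFun_iff_measure_inter_preimage_eq_mul]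
  intro S sets hs
  have hS : S = ∅ ∨ S = {true} ∨ S = {false} ∨ S = {true, false} := by
    clear hs; revert S; decide
  rcases hS with rfl | rfl | rfl | rfl
  · simp
  · simp
  · simp
  · have := h.measure_inter_preimage_eq_mul (sets true) (sets false) (hs _ (by simp))
      (hs _ (by simp))
    have e : ⋂ i ∈ ({true, false} : Finset Bool), X i ⁻¹' sets i =
        X true ⁻¹' sets true ∩ X false ⁻¹' sets false := by
      ext ω; simp [and_comm]
    rw [e, this]
    simp

section Law
variable {Ω : Type*} [MeasurableSpace Ω] {P : Measure Ω} [IsProbabilityMeasure P]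
  {A B : ℕ → Ω → ℕ}

lemma measurable_occupancy (hA : ∀ t, Measurable (A t)) (hB : ∀ t, Measurable (B t)) (t : ℕ) :
    Measurable (occupancy A B t) := by
  induction t with
  | zero => exact measurable_const
  | succ t ih =>
    exact (Measurable.of_discrete (f := fun p : (ℕ × ℕ) × (ℕ × ℕ) => step p.1 p.2.1 p.2.2)).comp
      (ih.prodMk ((hA t).prodMk (hB t)))

/-- The occupancies at time `t` are independent of the arrivals in the next time slot. -/
lemma indepFun_occupancy (hA : ∀ t, Measurable (A t)) (hB : ∀ t, Measurable (B t))
    (hA_indep : iIndepFun A P) (hB_indep : iIndepFun B P)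
    (hAB : IndepFun (fun ω t => A t ω) (fun ω t => B t ω) P) (t : ℕ) :
    IndepFun (occupancy A B t) (fun ω => (A t ω, B t ω)) P := by
  set X : Bool → ℕ → Ω → ℕ := fun i => if i then A else B with hX
  have mX : ∀ i j, Measurable (X i j) := fun i j => by
    cases i
    · exact hB j
    · exact hA j
  have hind : iIndepFun (fun (p : Bool × ℕ) ω => X p.1 p.2 ω) P := by
    refine iIndepFun_uncurry' mX (iIndepFun_bool hAB) fun i => ?_
    cases i
    · exact hB_indep
    · exact hA_indep
  have h := hind.indepFun_finset (Finset.univ ×ˢ Finset.range t) (Finset.univ ×ˢ {t})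
    (by
      rw [Finset.disjoint_left]
      rintro ⟨i, j⟩ h1 h2
      simp only [Finset.mem_product, Finset.mem_univ, true_and, Finset.mem_range,
        Finset.mem_singleton] at h1 h2
      omega) (fun p => mX p.1 p.2)
  set S : Finset (Bool × ℕ) := Finset.univ ×ˢ Finset.range t with hS
  set S' : Finset (Bool × ℕ) := Finset.univ ×ˢ {t} with hS'
  let g : (S → ℕ) → ℕ × ℕ := fun x =>
    occupancy (Ω := Unit) (fun s _ => if h : (true, s) ∈ S then x ⟨_, h⟩ else 0)
      (fun s _ => if h : (false, s) ∈ S then x ⟨_, h⟩ else 0) t ()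
  let g' : (S' → ℕ) → ℕ × ℕ := fun x =>
    (x ⟨(true, t), by simp [hS']⟩, x ⟨(false, t), by simp [hS']⟩)
  have h2 := h.comp (φ := g) (ψ := g') Measurable.of_discrete Measurable.of_discrete
  convert! h2 using 1
  funext ω
  simp only [Function.comp, g]
  refine occupancy_congr t (fun s hs => ?_) fun s hs => ?_
  · rw [dif_pos (by simp [hS, hs])]; rfl
  · rw [dif_pos (by simp [hS, hs])]; rfl

lemma lintegral_toMeasure {α : Type*} [MeasurableSpace α] [Countable α]
    [MeasurableSingletonClass α] (p : PMF α) (h : α → ℝ≥0∞) :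
    ∫⁻ x, h x ∂p.toMeasure = expect p h := by
  rw [lintegral_countable', expect]
  exact tsum_congr fun x => by
    rw [PMF.toMeasure_apply_singleton _ _ (measurableSet_singleton x), mul_comm]

/-- The law of the occupancies at time `t` is `law a b t`, stated through integrals. -/
lemma lintegral_occupancy (a b : PMF ℕ) (hA : ∀ t, Measurable (A t)) (hB : ∀ t, Measurable (B t))
    (hA_law : ∀ t, P.map (A t) = a.toMeasure) (hB_law : ∀ t, P.map (B t) = b.toMeasure)
    (hA_indep : iIndepFun A P) (hB_indep : iIndepFun B P)
    (hAB : IndepFun (fun ω t => A t ω) (fun ω t => B t ω) P) (t : ℕ) (h : ℕ × ℕ → ℝ≥0∞) :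
    ∫⁻ ω, h (occupancy A B t ω) ∂P = expect (law a b t) h := by
  induction t generalizing h with
  | zero => simp [occupancy, law_zero, expect_pure]
  | succ t ih =>
    have mZ := measurable_occupancy hA hB t
    have mAB : Measurable fun ω => (A t ω, B t ω) := (hA t).prodMk (hB t)
    have hZ : (fun ω => h (occupancy A B (t + 1) ω)) = fun ω =>
      (fun p : (ℕ × ℕ) × (ℕ × ℕ) => h (step p.1 p.2.1 p.2.2))
        (occupancy A B t ω, (A t ω, B t ω)) := rfl
    have e2 : P.map (fun ω => (A t ω, B t ω)) = a.toMeasure.prod b.toMeasure := by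
      have hi : IndepFun (A t) (B t) P :=
        hAB.comp (φ := fun f : ℕ → ℕ => f t) (ψ := fun f : ℕ → ℕ => f t) (measurable_pi_apply t)
          (measurable_pi_apply t)
      rw [(indepFun_iff_map_prod_eq_prod_map_map (hA t).aemeasurable (hB t).aemeasurable).1 hi,
        hA_law, hB_law]
    have e1 := (indepFun_iff_map_prod_eq_prod_map_map mZ.aemeasurable mAB.aemeasurable).1
      (indepFun_occupancy hA hB hA_indep hB_indep hAB t)
    rw [hZ, ← lintegral_map (f := fun p : (ℕ × ℕ) × (ℕ × ℕ) => h (step p.1 p.2.1 p.2.2))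
      Measurable.of_discrete (mZ.prodMk mAB), e1, e2,
      lintegral_prod _ Measurable.of_discrete.aemeasurable,
      lintegral_map Measurable.of_discrete mZ, expect_law_succ, ← ih]
    refine lintegral_congr fun ω => ?_
    rw [lintegral_prod _ Measurable.of_discrete.aemeasurable, lintegral_toMeasure,
      expect_transition]
    simp only [lintegral_toMeasure]

end Law

/-! ### The functional equation of the stationary law -/

/-- Coefficients of `S(B(y))`, where `S(u) = (1 - T_A(u)) / (1 - u)`. -/
noncomputable def forestTail (a b : PMF ℕ) : ℕ → ℝ≥0∞ := compCoeff (tail (treeCoeff a)) b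

/-- Coefficients of `Q(y) = (1 - T_A(B(y))) / (1 - y)`, factored as
`(1 - B(y)) / (1 - y) * S(B(y))`. -/
noncomputable def stepCoeff (a b : PMF ℕ) : ℕ → ℝ≥0∞ := conv (tail b) (forestTail a b)

lemma egf_forestTail (a b : PMF ℕ) (y : ℝ≥0∞) :
    egf (forestTail a b) y = egf (tail (treeCoeff a)) (egf b y) := egf_compCoeff _ _ _

lemma egf_stepCoeff (a b : PMF ℕ) (y : ℝ≥0∞) :
    egf (stepCoeff a b) y = egf (tail b) y * egf (tail (treeCoeff a)) (egf b y) := by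
  rw [stepCoeff, egf_conv, egf_forestTail]

lemma egf_pmf_one (b : PMF ℕ) : egf b 1 = 1 := by rw [egf_one, b.tsum_coe]

lemma egf_pmf_le_one (b : PMF ℕ) {y : ℝ≥0∞} (hy : y ≤ 1) : egf b y ≤ 1 :=
  (egf_mono b hy).trans (egf_pmf_one b).le

/-- The definition of `Q`, free of subtraction and division. -/
lemma treeComp_add_step (a b : PMF ℕ) (ha : egf (tail a) 1 < 1) {y : ℝ≥0∞} (hB : egf b y ≠ ∞)
    (hS : egf (tail (treeCoeff a)) (egf b y) ≠ ∞) :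
    egf (treeCoeff a) (egf b y) + egf (stepCoeff a b) y = 1 + y * egf (stepCoeff a b) y := by
  have h1 := egf_add_egf_tail (treeCoeff a) (egf b y)
  have h2 := egf_add_egf_tail b y
  rw [tsum_treeCoeff a ha] at h1
  rw [b.tsum_coe] at h2
  rw [egf_stepCoeff]
  generalize egf (tail (treeCoeff a)) (egf b y) = S at *
  generalize egf (treeCoeff a) (egf b y) = f at *
  generalize egf (tail b) y = C at *
  generalize egf b y = B at *
  have hfin : S + B * S ≠ ∞ := ENNReal.add_ne_top.2 ⟨hS, ENNReal.mul_ne_top hB hS⟩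
  refine (ENNReal.add_left_inj hfin).1 ?_
  calc f + C * S + (S + B * S) = (f + S) + (B + C) * S := by ring
    _ = (1 + B * S) + (1 + y * C) * S := by rw [h1, h2]
    _ = 1 + y * (C * S) + (S + B * S) := by ring

/-- The branching equation `T = u A(T)` rewritten for `S = (1 - T) / (1 - u)`, where
`τ = (1 - A(T)) / (1 - T)`. -/
lemma tail_equation_aux {u T S A τ : ℝ≥0∞} (hS : S ≠ ∞) (hτ : τ ≠ ∞) (hT : T ≠ ∞)
    (hA : A ≠ ∞) (hu : u < 1) (h1 : T + S = 1 + u * S) (h2 : A + τ = 1 + T * τ)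
    (h3 : T = u * A) : S = 1 + u * (S * τ) := by
  lift u to NNReal using hu.ne_top
  lift S to NNReal using hS
  lift τ to NNReal using hτ
  lift T to NNReal using hT
  lift A to NNReal using hA
  norm_cast at *
  rw [← NNReal.coe_inj] at *
  rw [← NNReal.coe_lt_coe] at hu
  push_cast at *
  have hu' : (1 - u : ℝ) ≠ 0 := by linarith
  refine mul_left_cancel₀ hu' ?_
  linear_combination (1 - u * τ) * h1 - u * h2 - h3

/-- The equation `S(1) = 1 + λ_A S(1)` for the mean `S(1)` of the total size of the tree. -/
lemma mean_size_eq (a : PMF ℕ) (ha : egf (tail a) 1 < 1)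
    (hS : egf (tail (treeCoeff a)) 1 ≠ ∞) :
    egf (tail (treeCoeff a)) 1 = 1 + egf (tail (treeCoeff a)) 1 * egf (tail a) 1 := by
  have hT1 : egf (treeCoeff a) 1 = 1 := by rw [egf_one, tsum_treeCoeff a ha]
  have key : tail (treeCoeff a) =
      Pi.single 0 1 + shift (conv (tail (treeCoeff a)) (compCoeff (tail a) (treeCoeff a))) := by
    refine eq_of_egf_eq (fun u h0 h1 => ?_) fun u h0 h1 =>
      ne_top_of_le_ne_top hS (egf_mono _ h1.le)
    rw [egf_add, egf_single, egf_shift, egf_conv, egf_compCoeff]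
    have hT : egf (treeCoeff a) u ≤ 1 := hT1 ▸ egf_mono _ h1.le
    have e1 := egf_add_egf_tail (treeCoeff a) u
    rw [tsum_treeCoeff a ha] at e1
    have e2 := egf_add_egf_tail a (egf (treeCoeff a) u)
    rw [a.tsum_coe] at e2
    exact tail_equation_aux (ne_top_of_le_ne_top hS (egf_mono _ h1.le))
      (ne_top_of_le_ne_top ha.ne_top (egf_mono _ hT)) (ne_top_of_le_ne_top ENNReal.one_ne_top hT)
      (ne_top_of_le_ne_top ENNReal.one_ne_top (egf_pmf_le_one a hT)) h1 e1 e2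
      (egf_treeCoeff_eq a u)
  conv_lhs => rw [key]
  rw [egf_add, egf_single, egf_shift, egf_conv, egf_compCoeff, hT1, one_mul]

/-- Pointwise bookkeeping of one time slot according to which of the two queues are empty. -/
lemma expect_kernel (p : PMF (ℕ × ℕ)) (x y : ℝ≥0∞) :
    x * y * expect p (fun s => x ^ (s.1 - 1) * y ^ (s.2 - 1 + if 0 < s.1 then 1 else 0)) +
        y * expect p (fun s => if s.1 = 0 then y ^ s.2 else 0) +
        y * expect p (fun s => if s.2 = 0 then x ^ s.1 else 0) + (x + y ^ 2) * p (0, 0) =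
      y * expect p (fun s => x ^ s.1 * y ^ s.2) +
        x * expect p (fun s => if s.1 = 0 then y ^ s.2 else 0) +
        y ^ 2 * expect p (fun s => if s.2 = 0 then x ^ s.1 else 0) + (x * y + y) * p (0, 0) := by
  rw [← expect_single p (0, 0)]
  simp only [← expect_mul_left, ← expect_add]
  congr 1
  funext ⟨m, n⟩
  rcases m with _ | m <;> rcases n with _ | n <;> simp <;> ring

/-- In equilibrium, the generating function after the arrivals is the one before them times
`A(x) B(y)`. -/
lemma stationary_kernel (a b : PMF ℕ) {π : PMF (ℕ × ℕ)} (hπ : IsStationary a b π) (x y : ℝ≥0∞) :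
    expect π (fun s => x ^ s.1 * y ^ s.2) = egf a x * egf b y *
      expect π (fun s => x ^ (s.1 - 1) * y ^ (s.2 - 1 + if 0 < s.1 then 1 else 0)) := by
  conv_lhs => rw [← hπ]
  rw [expect_bind, ← expect_mul_left]
  congr 1
  funext s
  rw [expect_transition]
  have : ∀ i j, x ^ (step s i j).1 * y ^ (step s i j).2 =
      (x ^ (s.1 - 1) * y ^ (s.2 - 1 + if 0 < s.1 then 1 else 0)) * (x ^ i * y ^ j) := by
    intro i j
    simp only [step, pow_add]
    ring
  simp only [this, expect_mul_left]
  rw [show (expect a fun i => x ^ i * expect b fun j => y ^ j) = egf a x * egf b y from by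
    rw [expect_mul_right]; rfl]
  ring

/-- The algebra of the kernel method at a fixed `y`. Here `p` is the probability of `(0, 0)`,
`G0 = E[y^Y; X = 0]`, `G1 = E[y^Y]`, `A = A(f)`, `B = B(y)`, `C = (1 - B) / (1 - y)` and
`S = S(B)`; `Φ1` and `Φ2` are the generating functions just before the arrivals, at `x = f` and
`x = 1`. The hypotheses `k1` and `k2` are `expect_kernel` at these two points. -/
lemma renewal_equation_aux {y κ p G0 Φ1 Φ2 G1 V A B C S f : ℝ} (hy : y ≠ 0) (hy1 : 1 - y ≠ 0)
    (hC : C ≠ 0) (hf : f = A * B)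
    (k1 : f * y * Φ1 + y * G0 + y * (A * κ) + (f + y ^ 2) * p =
      y * (A * B * Φ1) + f * G0 + y ^ 2 * (A * κ) + (f * y + y) * p)
    (k2 : y * Φ2 + y * G0 + y * κ + (1 + y ^ 2) * p =
      y * G1 + G0 + y ^ 2 * κ + (y + y) * p)
    (hG1 : G1 = B * Φ2) (hV : G1 + κ * y = κ + y * V) (hB : B + C = 1 + y * C)
    (hQ : f + C * S = 1 + y * (C * S)) :
    V = C * S * V + κ * S := by
  -- on the kernel `x = f(y)`
  have e1 : (1 - C * S) * (G0 - (1 - y) * p) = y * κ * A := by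
    refine mul_left_cancel₀ hy1 ?_
    have e0 : (f - y) * (G0 - (1 - y) * p) = (1 - y) * (y * κ * A) := by
      linear_combination -k1 + y * Φ1 * hf
    have e0' : f - y = (1 - y) * (1 - C * S) := by linear_combination hQ
    rw [← e0, e0']; ring
  -- at `x = 1`
  have e2 : y * G1 * C = B * (G0 - (1 - y) * p - y * κ) := by
    refine mul_left_cancel₀ hy1 ?_
    linear_combination B * k2 + y * G1 * hB + y * hG1
  have e3 : G1 * C * (1 - C * S) = κ * (f - B * (1 - C * S)) := by
    refine mul_left_cancel₀ hy ?_
    linear_combination (1 - C * S) * e2 + B * e1 - y * κ * hf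
  refine mul_left_cancel₀ (mul_ne_zero hy hC) ?_
  linear_combination e3 - C * (1 - C * S) * hV + κ * hQ - κ * (1 - C * S) * hB

/-- The law of the second queue shifted by one, with the probability `κ` of emptiness added at
the origin: the coefficients of `(E[y^Y] - κ (1 - y)) / y`. -/
noncomputable def shiftedLaw (π : PMF (ℕ × ℕ)) (n : ℕ) : ℝ≥0∞ :=
  ∑' m, π (m, n + 1) + if n = 0 then ∑' m, π (m, 0) else 0

lemma tsum_prod_eq_expect_snd (π : PMF (ℕ × ℕ)) (h : ℕ → ℝ≥0∞) :
    expect π (fun s => h s.2) = ∑' n, (∑' m, π (m, n)) * h n := by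
  rw [expect, ENNReal.tsum_prod', ENNReal.tsum_comm]
  simp only [ENNReal.tsum_mul_right]

lemma tsum_zero_eq_expect (π : PMF (ℕ × ℕ)) :
    ∑' m, π (m, 0) = expect π (fun s => if s.2 = 0 then 1 else 0) := by
  refine Eq.symm ((tsum_prod_eq_expect_snd π fun n => if n = 0 then 1 else 0).trans
    ((tsum_eq_single 0 fun n hn => ?_).trans ?_))
  · rw [if_neg hn, mul_zero]
  · rw [if_pos rfl, mul_one]

lemma egf_shiftedLaw (π : PMF (ℕ × ℕ)) (y : ℝ≥0∞) :
    expect π (fun s => y ^ s.2) + (∑' m, π (m, 0)) * y =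
      ∑' m, π (m, 0) + y * egf (shiftedLaw π) y := by
  have h1 : expect π (fun s => y ^ s.2) = egf (fun n => ∑' m, π (m, n)) y :=
    tsum_prod_eq_expect_snd π (fun n => y ^ n)
  have h2 : shiftedLaw π = (fun n => ∑' m, π (m, n + 1)) +
      fun n => (∑' m, π (m, 0)) * (Pi.single 0 1 : ℕ → ℝ≥0∞) n := by
    funext n
    simp only [shiftedLaw, Pi.add_apply, Pi.single_apply]
    split_ifs <;> simp
  rw [h1, egf_succ, h2, egf_add, egf_smul, egf_single]
  ring

lemma expect_le_one {α : Type*} (p : PMF α) {h : α → ℝ≥0∞} (hh : ∀ s, h s ≤ 1) :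
    expect p h ≤ 1 := (expect_mono p hh).trans (expect_const p 1).le

/-- The renewal equation for the stationary law of the second queue, by the kernel method: the
joint generating function is evaluated on the curve `x = T_A(B(y))`, where the kernel
`x - A(x) B(y)` vanishes, and on the line `x = 1`. -/
lemma renewal_equation (a b : PMF ℕ) (hab : egf (tail a) 1 + egf (tail b) 1 < 1)
    (hS : egf (tail (treeCoeff a)) 1 ≠ ∞) (hb : ∃ n, tail b n ≠ 0)
    {π : PMF (ℕ × ℕ)} (hπ : IsStationary a b π) :
    shiftedLaw π = conv (stepCoeff a b) (shiftedLaw π) +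
      fun n => (∑' m, π (m, 0)) * forestTail a b n := by
  have ha : egf (tail a) 1 < 1 := lt_of_le_of_lt le_self_add hab
  have hb1 : egf (tail b) 1 < 1 := lt_of_le_of_lt le_add_self hab
  set κ := ∑' m, π (m, 0) with hκ
  have one_top := ENNReal.one_ne_top
  have hκ1 : κ ≤ 1 := by
    rw [hκ, tsum_zero_eq_expect]
    exact expect_le_one _ fun s => by split_ifs <;> simp
  have hT1 : egf (treeCoeff a) 1 = 1 := by rw [egf_one, tsum_treeCoeff a ha]
  have bound : ∀ y : ℝ≥0∞, 0 < y → y < 1 → egf (shiftedLaw π) y ≠ ∞ := by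
    intro y h0 h1 ht
    have := egf_shiftedLaw π y
    rw [ht, ENNReal.mul_top h0.ne', add_top] at this
    refine absurd this (ENNReal.add_ne_top.2 ⟨?_, ENNReal.mul_ne_top ?_ h1.ne_top⟩)
    · exact ne_top_of_le_ne_top one_top (expect_le_one _ fun s => pow_le_one₀ zero_le h1.le)
    · exact ne_top_of_le_ne_top one_top hκ1
  refine eq_of_egf_eq (fun y h0 h1 => ?_) bound
  rw [egf_add, egf_conv, egf_smul, egf_stepCoeff, egf_forestTail]
  have hB1 : egf b y ≤ 1 := egf_pmf_le_one b h1.le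
  set f := egf (treeCoeff a) (egf b y) with hf
  have hf1 : f ≤ 1 := hT1 ▸ egf_mono _ hB1
  have hSB : egf (tail (treeCoeff a)) (egf b y) ≠ ∞ := ne_top_of_le_ne_top hS (egf_mono _ hB1)
  have hff := egf_treeCoeff_eq a (egf b y)
  rw [← hf] at hff
  have hQ := treeComp_add_step a b ha (ne_top_of_le_ne_top one_top hB1) hSB
  rw [egf_stepCoeff, ← hf] at hQ
  have hBC := egf_add_egf_tail b y
  rw [b.tsum_coe] at hBC
  have hV := egf_shiftedLaw π y
  rw [← hκ] at hV
  have hK : ∀ x, expect π (fun s => if s.2 = 0 then x ^ s.1 else 0) = egf a x * κ := fun x => by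
    rw [hκ, tsum_zero_eq_expect, ← hπ, expect_snd_zero_of_bind]
  have k1 := expect_kernel π f y
  have k2 := expect_kernel π 1 y
  rw [stationary_kernel a b hπ, hK] at k1
  have hG1 := stationary_kernel a b hπ 1 y
  rw [hK] at k2
  simp only [one_pow, one_mul, egf_pmf_one] at k2 hG1
  have hC : egf (tail b) y ≠ 0 := by
    obtain ⟨n, hn⟩ := hb
    intro h
    have := ENNReal.tsum_eq_zero.1 h n
    rcases mul_eq_zero.1 this with h | h
    · exact hn h
    · exact h0.ne' (eq_zero_of_pow_eq_zero h)
  -- all quantities are finite, so that the algebra takes place in `ℝ`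
  have hV' := bound y h0 h1
  have hA1 : egf a f ≤ 1 := egf_pmf_le_one a hf1
  have hC1 : egf (tail b) y ≠ ∞ := ne_top_of_le_ne_top hb1.ne_top (egf_mono _ h1.le)
  have hΦ1 : expect π (fun s => f ^ (s.1 - 1) * y ^ (s.2 - 1 + if 0 < s.1 then 1 else 0)) ≤ 1 :=
    expect_le_one _ fun s => mul_le_one' (pow_le_one₀ zero_le hf1) (pow_le_one₀ zero_le h1.le)
  have hΦ2 : expect π (fun s => y ^ (s.2 - 1 + if 0 < s.1 then 1 else 0)) ≤ 1 :=
    expect_le_one _ fun s => pow_le_one₀ zero_le h1.le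
  have hG01 : expect π (fun s => if s.1 = 0 then y ^ s.2 else 0) ≤ 1 :=
    expect_le_one _ fun s => by split_ifs <;> simp [pow_le_one₀, h1.le]
  have hG11 : expect π (fun s => y ^ s.2) ≤ 1 :=
    expect_le_one _ fun s => pow_le_one₀ zero_le h1.le
  have hp1 : π (0, 0) ≤ 1 := π.coe_le_one _
  generalize expect π (fun s => f ^ (s.1 - 1) * y ^ (s.2 - 1 + if 0 < s.1 then 1 else 0)) = Φ1 at *
  generalize expect π (fun s => y ^ (s.2 - 1 + if 0 < s.1 then 1 else 0)) = Φ2 at *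
  generalize expect π (fun s => if s.1 = 0 then y ^ s.2 else 0) = G0 at *
  generalize expect π (fun s => y ^ s.2) = G1 at *
  generalize π (0, 0) = p at *
  generalize egf (shiftedLaw π) y = V at *
  generalize egf (tail (treeCoeff a)) (egf b y) = S at *
  generalize egf (tail b) y = C at *
  generalize egf a f = A at *
  generalize egf b y = B at *
  clear_value κ f
  clear hf hκ hK bound hT1 hS hb hab ha hb1
  lift Φ1 to NNReal using ne_top_of_le_ne_top one_top hΦ1
  lift Φ2 to NNReal using ne_top_of_le_ne_top one_top hΦ2
  lift G0 to NNReal using ne_top_of_le_ne_top one_top hG01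
  lift G1 to NNReal using ne_top_of_le_ne_top one_top hG11
  lift p to NNReal using ne_top_of_le_ne_top one_top hp1
  lift A to NNReal using ne_top_of_le_ne_top one_top hA1
  lift B to NNReal using ne_top_of_le_ne_top one_top hB1
  lift f to NNReal using ne_top_of_le_ne_top one_top hf1
  lift κ to NNReal using ne_top_of_le_ne_top one_top hκ1
  lift V to NNReal using hV'
  lift S to NNReal using hSB
  lift C to NNReal using hC1
  lift y to NNReal using h1.ne_top
  norm_cast at *
  rw [← NNReal.coe_inj] at k1 k2 hff hQ hBC hV hG1 ⊢
  rw [← NNReal.coe_lt_coe] at h0 h1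
  have hC' : (C : ℝ) ≠ 0 := by exact_mod_cast hC
  push_cast at *
  exact renewal_equation_aux (y := y) (p := p) (G0 := G0) (Φ1 := Φ1) (Φ2 := Φ2) (G1 := G1)
    (A := A) (B := B) (f := f) h0.ne' (by linarith) hC' (by linarith) (by linarith) (by linarith)
    (by linarith) (by linarith) (by linarith) (by linarith)

/-! ### The dominant singularity -/

lemma coeff_ne_top {c : ℕ → ℝ≥0∞} {y : ℝ≥0∞} (hy : y ≠ 0) (h : egf c y ≠ ∞) (n : ℕ) :
    c n ≠ ∞ := by
  intro ht
  have := ENNReal.ne_top_of_tsum_ne_top h n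
  rw [ht] at this
  exact this (ENNReal.top_mul (pow_ne_zero n hy))

lemma hasSum_toReal_egf {c : ℕ → ℝ≥0∞} {v : ℝ} (hv : 0 ≤ v) (h : egf c (ENNReal.ofReal v) ≠ ∞) :
    HasSum (fun n => (c n).toReal * v ^ n) (egf c (ENNReal.ofReal v)).toReal := by
  have := ENNReal.hasSum_toReal h
  rw [← ENNReal.tsum_toReal_eq (ENNReal.ne_top_of_tsum_ne_top h)] at this
  simpa [ENNReal.toReal_mul, ENNReal.toReal_pow, ENNReal.toReal_ofReal hv, egf,
    ENNReal.tsum_toReal_eq (ENNReal.ne_top_of_tsum_ne_top h)] using this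

/-- Beyond `1`, a generating function other than the constant `1` exceeds `1`. -/
lemma one_lt_egf {b : PMF ℕ} (hb : ∃ n, tail b n ≠ 0) {y : ℝ≥0∞} (hy : 1 < y) (hy' : y ≠ ∞)
    (hB : egf b y ≠ ∞) : 1 < egf b y := by
  have hC := egf_tail_ne_top b hy hB hy'
  have h := egf_add_egf_tail b y
  rw [b.tsum_coe] at h
  have hC0 : egf (tail b) y ≠ 0 := by
    obtain ⟨n, hn⟩ := hb
    intro h
    exact mul_ne_zero hn (pow_ne_zero n (zero_lt_one.trans hy).ne') (ENNReal.tsum_eq_zero.1 h n)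
  refine (ENNReal.add_lt_add_iff_right hC).1 ?_
  rw [h]
  refine (ENNReal.add_lt_add_iff_left ENNReal.one_ne_top).2 ?_
  conv_lhs => rw [← one_mul (egf (tail b) y)]
  exact (ENNReal.mul_lt_mul_iff_left hC0 hC).2 hy

/-- `Q` converges beyond `1` wherever `T_A ∘ B` does. -/
lemma egf_stepCoeff_ne_top {a b : PMF ℕ} (hb : ∃ n, tail b n ≠ 0) {y : ℝ≥0∞} (hy : 1 < y)
    (hy' : y ≠ ∞) (hB : egf b y ≠ ∞) (hT : egf (treeCoeff a) (egf b y) ≠ ∞) :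
    egf (tail (treeCoeff a)) (egf b y) ≠ ∞ ∧ egf (stepCoeff a b) y ≠ ∞ := by
  have h := egf_tail_ne_top _ (one_lt_egf hb hy hy' hB) hT hB
  refine ⟨h, ?_⟩
  rw [egf_stepCoeff]
  exact ENNReal.mul_ne_top (egf_tail_ne_top b hy hB hy') h

/-- The relation `T_A(B(v)) = 1 - (1 - v) Q(v)` on the real line. -/
lemma treeGenFun_eq_step {a b : PMF ℕ} (ha : egf (tail a) 1 < 1) (hb : ∃ n, tail b n ≠ 0)
    {v : ℝ} (hv : 1 < v) (h : treeGenFun a (genFun b v) ≠ 0) :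
    Summable (fun n => (stepCoeff a b n).toReal * v ^ n) ∧
      treeGenFun a (genFun b v) = 1 - (1 - v) * ∑' n, (stepCoeff a b n).toReal * v ^ n := by
  have hv0 : 0 ≤ v := by linarith
  obtain ⟨hB, hT, e⟩ := finite_of_treeGenFun_ne_zero hv0 h
  have hy : 1 < ENNReal.ofReal v := by rwa [ENNReal.one_lt_ofReal]
  obtain ⟨hS, hQ⟩ := egf_stepCoeff_ne_top hb hy ENNReal.ofReal_ne_top hB hT
  have hs := hasSum_toReal_egf hv0 hQ
  refine ⟨hs.summable, ?_⟩
  rw [hs.tsum_eq, e]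
  have := congrArg ENNReal.toReal (treeComp_add_step a b ha hB hS)
  rw [ENNReal.toReal_add hT hQ, ENNReal.toReal_add ENNReal.one_ne_top
    (ENNReal.mul_ne_top ENNReal.ofReal_ne_top hQ), ENNReal.toReal_mul, ENNReal.toReal_one,
    ENNReal.toReal_ofReal hv0] at this
  linarith

/-- The step law is nonincreasing, being a sequence of tails. -/
lemma stepCoeff_antitone (a b : PMF ℕ) (ha : egf (tail a) 1 < 1) (hb : egf (tail b) 1 ≠ ∞)
    (hS : egf (tail (treeCoeff a)) 1 ≠ ∞) : Antitone (stepCoeff a b) := by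
  have key : compCoeff (treeCoeff a) b + stepCoeff a b =
      Pi.single 0 1 + shift (stepCoeff a b) := by
    have hT1 : egf (treeCoeff a) 1 = 1 := by rw [egf_one, tsum_treeCoeff a ha]
    refine eq_of_egf_eq (fun y h0 h1 => ?_) fun y h0 h1 => ?_
    · rw [egf_add, egf_add, egf_single, egf_shift, egf_compCoeff]
      have hB1 : egf b y ≤ 1 := egf_pmf_le_one b h1.le
      exact treeComp_add_step a b ha (ne_top_of_le_ne_top ENNReal.one_ne_top hB1)
        (ne_top_of_le_ne_top hS (egf_mono _ hB1))
    · have hB1 : egf b y ≤ 1 := egf_pmf_le_one b h1.le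
      rw [egf_add, egf_compCoeff, egf_stepCoeff]
      refine ENNReal.add_ne_top.2 ⟨ne_top_of_le_ne_top ENNReal.one_ne_top (hT1 ▸ egf_mono _ hB1),
        ENNReal.mul_ne_top (ne_top_of_le_ne_top hb (egf_mono _ h1.le))
          (ne_top_of_le_ne_top hS (egf_mono _ hB1))⟩
  refine antitone_nat_of_succ_le fun n => ?_
  have := congrFun key (n + 1)
  simp only [Pi.add_apply, shift] at this
  rw [Pi.single_eq_of_ne (Nat.succ_ne_zero n), zero_add] at this
  rw [← this]
  exact le_add_self

lemma egf_shiftedLaw_one (π : PMF (ℕ × ℕ)) : egf (shiftedLaw π) 1 = 1 := by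
  have h := egf_shiftedLaw π 1
  have hκ : ∑' m, π (m, 0) ≠ ∞ := by
    rw [tsum_zero_eq_expect]
    exact ne_top_of_le_ne_top ENNReal.one_ne_top
      (expect_le_one _ fun s => by split_ifs <;> simp)
  simp only [one_pow, expect_const, mul_one, one_mul] at h
  rw [add_comm] at h
  exact ((ENNReal.add_right_inj hκ).1 h).symm

/-- The stationary probability that the second queue is empty, and the defect of `Q(1)`. -/
lemma empty_probability (a b : PMF ℕ) {lamA lamB : ℝ} (hA : egf (tail a) 1 = ENNReal.ofReal lamA)
    (hB : egf (tail b) 1 = ENNReal.ofReal lamB) (hA0 : 0 ≤ lamA) (hB0 : 0 ≤ lamB)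
    (hlam : lamA + lamB < 1) (hS : egf (tail (treeCoeff a)) 1 ≠ ∞) (hb : ∃ n, tail b n ≠ 0)
    {π : PMF (ℕ × ℕ)} (hπ : IsStationary a b π) :
    (∑' m, π (m, 0)).toReal = 1 - lamA - lamB ∧ egf (stepCoeff a b) 1 < 1 := by
  have hab : egf (tail a) 1 + egf (tail b) 1 < 1 := by
    rw [hA, hB, ← ENNReal.ofReal_add hA0 hB0]
    exact ENNReal.ofReal_lt_one.2 hlam
  have e1 := mean_size_eq a (lt_of_le_of_lt le_self_add hab) hS
  have e2 := congrArg (fun c => egf c 1) (renewal_equation a b hab hS hb hπ)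
  simp only [egf_add, egf_conv, egf_smul, egf_forestTail, egf_shiftedLaw_one, egf_pmf_one,
    mul_one] at e2
  have e3 := egf_stepCoeff a b 1
  rw [egf_pmf_one, hB] at e3
  rw [hA] at e1
  set κ := ∑' m, π (m, 0)
  have hκ : κ ≠ ∞ := by
    intro h
    rw [h] at e2
    have : egf (tail (treeCoeff a)) 1 ≠ 0 := by
      rw [e1]; exact (zero_lt_one.trans_le le_self_add).ne'
    rw [ENNReal.top_mul this, add_top] at e2
    exact ENNReal.one_ne_top e2
  rw [e3] at e2 ⊢
  generalize egf (tail (treeCoeff a)) 1 = S at *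
  have f1 := congrArg ENNReal.toReal e1
  rw [ENNReal.toReal_add ENNReal.one_ne_top (ENNReal.mul_ne_top hS ENNReal.ofReal_ne_top),
    ENNReal.toReal_mul, ENNReal.toReal_one, ENNReal.toReal_ofReal hA0] at f1
  have f2 := congrArg ENNReal.toReal e2
  rw [ENNReal.toReal_add (ENNReal.mul_ne_top ENNReal.ofReal_ne_top hS) (ENNReal.mul_ne_top hκ hS),
    ENNReal.toReal_mul, ENNReal.toReal_mul, ENNReal.toReal_one, ENNReal.toReal_ofReal hB0] at f2
  have hS0 : S.toReal ≠ 0 := by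
    intro h; rw [h] at f1; norm_num at f1
  have hSpos : 0 < S.toReal := lt_of_le_of_ne ENNReal.toReal_nonneg hS0.symm
  refine ⟨mul_left_cancel₀ hS0 (by linear_combination -f1 - f2), ?_⟩
  rw [← ENNReal.toReal_lt_toReal (ENNReal.mul_ne_top ENNReal.ofReal_ne_top hS) ENNReal.one_ne_top,
    ENNReal.toReal_mul, ENNReal.toReal_one, ENNReal.toReal_ofReal hB0]
  nlinarith

/-! ### The asymptotics of the second queue -/

/-- The renewal theorem applied to the stationary law tilted by `δⁿ`, where `Q(δ) = 1`. -/
lemma tendsto_shiftedLaw {q s v : ℕ → ℝ≥0∞} {κ : ℝ≥0∞} {δ d : ℝ} (hδ : 0 < δ)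
    (hv : ∀ n, v n ≠ ∞) (hκ : κ ≠ ∞) (hren : v = conv q v + fun n => κ * s n)
    (hq : egf q (ENNReal.ofReal δ) = 1) (hs : egf s (ENNReal.ofReal δ) ≠ ∞)
    (hq0 : (q 0).toReal < 1) (hq1 : q 1 ≠ 0)
    (hd : HasSum (fun n : ℕ => (q n).toReal * (n * δ ^ (n - 1))) d) :
    Tendsto (fun n => (v n).toReal * δ ^ n) atTop
      (𝓝 (κ.toReal * (egf s (ENNReal.ofReal δ)).toReal / (δ * d))) := by
  have hD0 : ENNReal.ofReal δ ≠ 0 := (ENNReal.ofReal_pos.2 hδ).ne'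
  have hqfin : egf q (ENNReal.ofReal δ) ≠ ∞ := hq ▸ ENNReal.one_ne_top
  have hqn := coeff_ne_top hD0 hqfin
  have hsn := coeff_ne_top hD0 hs
  have hqs : HasSum (fun n => (q n).toReal * δ ^ n) 1 := by
    have := hasSum_toReal_egf hδ.le hqfin
    rwa [hq, ENNReal.toReal_one] at this
  have hq1' : 0 < (q 1).toReal * δ ^ 1 :=
    mul_pos (ENNReal.toReal_pos hq1 (hqn 1)) (pow_pos hδ 1)
  set qe : ℕ → ℝ≥0∞ := fun n => q n * ENNReal.ofReal δ ^ n with hqe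
  have qe_real : ∀ n, (qe n).toReal = (q n).toReal * δ ^ n := fun n => by
    rw [hqe, ENNReal.toReal_mul, ENNReal.toReal_pow, ENNReal.toReal_ofReal hδ.le]
  have hqe1 : ∑' n, qe n = 1 := hq
  have qe_fin : ∀ n, qe n ≠ ∞ := ENNReal.ne_top_of_tsum_ne_top (hqe1 ▸ ENNReal.one_ne_top)
  have mean : egf (tail qe) 1 = ENNReal.ofReal (δ * d) := by
    have h1 : HasSum (fun n : ℕ => (n : ℝ) * ((q n).toReal * δ ^ n)) (δ * d) := by
      refine (hd.mul_left δ).congr_fun fun n => ?_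
      rcases n with _ | n
      · simp
      · simp only [Nat.add_sub_cancel]; ring
    rw [egf_tail_one, ← h1.tsum_eq, ENNReal.ofReal_tsum_of_nonneg _ h1.summable]
    · refine tsum_congr fun n => ?_
      rw [ENNReal.ofReal_mul (by positivity), ← qe_real, ENNReal.ofReal_toReal (qe_fin n),
        ENNReal.ofReal_natCast]
    · intro n; positivity
  have hd0 : 0 ≤ d := hd.nonneg fun n => by positivity
  have tail_fin : ∀ n, tail qe n ≠ ∞ := fun n =>
    coeff_ne_top one_ne_zero (by rw [mean]; exact ENNReal.ofReal_ne_top) n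
  have hQs : HasSum (fun n => (tail qe n).toReal) (δ * d) := by
    have := hasSum_toReal_egf (c := tail qe) (v := 1) zero_le_one
      (by rw [ENNReal.ofReal_one, mean]; exact ENNReal.ofReal_ne_top)
    rw [ENNReal.ofReal_one, mean, ENNReal.toReal_ofReal (by positivity)] at this
    simpa using this
  have hr : HasSum (fun n => κ.toReal * ((s n).toReal * δ ^ n))
      (κ.toReal * (egf s (ENNReal.ofReal δ)).toReal) :=
    (hasSum_toReal_egf hδ.le hs).mul_left _
  have hw : ∀ n, (v n).toReal * δ ^ n = ∑ k ∈ Finset.range (n + 1),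
      (q k).toReal * δ ^ k * ((v (n - k)).toReal * δ ^ (n - k)) +
        κ.toReal * ((s n).toReal * δ ^ n) := by
    intro n
    have h1 := congrFun hren n
    simp only [Pi.add_apply, conv] at h1
    rw [Finset.Nat.sum_antidiagonal_eq_sum_range_succ (fun i j => q i * v j)] at h1
    have h2 : ∀ k ∈ Finset.range (n + 1), q k * v (n - k) ≠ ∞ := fun k _ =>
      ENNReal.mul_ne_top (hqn k) (hv _)
    rw [h1, ENNReal.toReal_add (ENNReal.sum_ne_top.2 h2) (ENNReal.mul_ne_top hκ (hsn n)),
      ENNReal.toReal_sum h2, add_mul, Finset.sum_mul, ENNReal.toReal_mul]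
    congr 1
    · refine Finset.sum_congr rfl fun k hk => ?_
      have hk := Finset.mem_range.1 hk
      rw [ENNReal.toReal_mul, show δ ^ n = δ ^ k * δ ^ (n - k) by rw [← pow_add]; congr 1; omega]
      ring
    · ring
  refine tendsto_renewal (M := κ.toReal * (egf s (ENNReal.ofReal δ)).toReal /
      (1 - (q 0).toReal * δ ^ 0)) (q := fun n => (q n).toReal * δ ^ n)
    (r := fun n => κ.toReal * ((s n).toReal * δ ^ n))
    (fun n => by positivity) hqs hq1' ?_ ?_ (fun n => ENNReal.toReal_nonneg) hQs hr
    (fun n => ?_) hw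
  · have := tail_zero_add qe
    rw [hqe1] at this
    rw [← qe_real, ← ENNReal.toReal_add (qe_fin 0) (tail_fin 0), this, ENNReal.toReal_one]
  · intro n
    rw [← qe_real, ← ENNReal.toReal_add (qe_fin _) (tail_fin _), tail_succ_add]
  · rw [abs_of_nonneg (by positivity)]
    exact renewal_bounded (q := fun n => (q n).toReal * δ ^ n)
      (r := fun n => κ.toReal * ((s n).toReal * δ ^ n))
      (fun n => by positivity) hqs (by simpa using hq0) (fun n => by positivity) hr hw n

lemma tsum_ite_le (c : ℕ → ℝ≥0∞) (N : ℕ) :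
    ∑' k, c k * (if N ≤ k then 1 else 0) = ∑' k, c (N + k) := by
  rw [← (add_right_injective N).tsum_eq]
  · exact tsum_congr fun k => by rw [if_pos (Nat.le_add_right N k), mul_one]
  · intro k hk
    rw [Function.mem_support] at hk
    have : N ≤ k := by
      by_contra h
      exact hk (by rw [if_neg h, mul_zero])
    exact ⟨k - N, Nat.add_sub_cancel' this⟩

lemma measureReal_snd_ge (π : PMF (ℕ × ℕ)) (n : ℕ) :
    π.toMeasure.real {s : ℕ × ℕ | n + 2 ≤ s.2} = ∑' k, (shiftedLaw π (n + 1 + k)).toReal := by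
  have h1 : ∀ k, shiftedLaw π (n + 1 + k) = ∑' m, π (m, n + 2 + k) := fun k => by
    rw [shiftedLaw, if_neg (by omega), add_zero]
    exact tsum_congr fun m => by congr 2; omega
  have h2 : π.toMeasure {s : ℕ × ℕ | n + 2 ≤ s.2} = ∑' k, ∑' m, π (m, n + 2 + k) := by
    rw [← lintegral_indicator_one (MeasurableSet.of_discrete), lintegral_toMeasure]
    have : ({s : ℕ × ℕ | n + 2 ≤ s.2}.indicator (1 : ℕ × ℕ → ℝ≥0∞)) =
        fun s => (fun k => if n + 2 ≤ k then 1 else 0) s.2 := by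
      funext s
      simp [Set.indicator]
    rw [this, tsum_prod_eq_expect_snd π (fun k => if n + 2 ≤ k then 1 else 0), tsum_ite_le]
  rw [measureReal_def, h2, ENNReal.tsum_toReal_eq]
  · simp only [h1]
  · intro k
    rw [← h1]
    exact coeff_ne_top one_ne_zero (by rw [egf_shiftedLaw_one]; exact ENNReal.one_ne_top) _

/-- Geometric decay of the terms passes to the tails. -/
lemma tendsto_tail_of_tendsto {v : ℕ → ℝ} {δ L : ℝ} (hδ : 1 < δ)
    (h : Tendsto (fun n => v n * δ ^ n) atTop (𝓝 L)) :
    Tendsto (fun n => (∑' k, v (n + 1 + k)) * δ ^ (n + 2)) atTop (𝓝 (L * (δ ^ 2 / (δ - 1)))) := by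
  have h0 : 0 < δ := by linarith
  obtain ⟨M, hM⟩ := (Metric.isBounded_range_of_tendsto _ h).exists_norm_le
  have hsum : HasSum (fun k : ℕ => δ⁻¹ ^ k) (1 - δ⁻¹)⁻¹ :=
    hasSum_geometric_of_lt_one (by positivity) (inv_lt_one_of_one_lt₀ hδ)
  have hdom : Tendsto (fun n => ∑' k, (v (n + 1 + k) * δ ^ (n + 1 + k)) * δ⁻¹ ^ k) atTop
      (𝓝 (∑' k : ℕ, L * δ⁻¹ ^ k)) := by
    refine tendsto_tsum_of_dominated_convergence (bound := fun k => M * δ⁻¹ ^ k)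
      (hsum.summable.mul_left M) (fun k => ?_) (Eventually.of_forall fun n k => ?_)
    · refine Tendsto.mul_const _ ?_
      have := h.comp (tendsto_add_atTop_nat (1 + k))
      refine this.congr fun n => ?_
      simp only [Function.comp, add_assoc]
    · rw [norm_mul, Real.norm_of_nonneg (show 0 ≤ δ⁻¹ ^ k by positivity)]
      gcongr
      exact hM _ ⟨_, rfl⟩
  rw [tsum_mul_left, hsum.tsum_eq] at hdom
  have e : L * (δ ^ 2 / (δ - 1)) = L * (1 - δ⁻¹)⁻¹ * δ := by
    have : δ - 1 ≠ 0 := by linarith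
    have h1 : 1 - δ⁻¹ = (δ - 1) / δ := by field_simp
    rw [h1]; field_simp
  rw [e]
  refine (hdom.mul_const δ).congr fun n => ?_
  rw [← tsum_mul_right, ← tsum_mul_right]
  refine tsum_congr fun k => ?_
  have : δ ^ (n + 1 + k) * δ⁻¹ ^ k = δ ^ (n + 1) := by
    rw [pow_add, mul_assoc, ← mul_pow, mul_inv_cancel₀ h0.ne', one_pow, mul_one]
  rw [mul_assoc (v _), this]
  ring

/-- Asymptotics of the stationary law of the second queue, whose decay rate is the solution
`δ > 1` of `δ = T_A(B(δ))`. -/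
theorem tendsto_measureReal_snd (a b : PMF ℕ) {lamA lamB δ : ℝ}
    (hA : egf (tail a) 1 = ENNReal.ofReal lamA) (hB : egf (tail b) 1 = ENNReal.ofReal lamB)
    (hA0 : 0 ≤ lamA) (hB0 : 0 ≤ lamB) (hlam : lamA + lamB < 1) (hδ : 1 < δ)
    (hfix : treeGenFun a (genFun b δ) = δ)
    (hdiff : DifferentiableAt ℝ (fun v => treeGenFun a (genFun b v)) δ)
    {π : PMF (ℕ × ℕ)} (hπ : IsStationary a b π) :
    ((1 - lamA - lamB) * δ * (δ - 1)) / ((1 - genFun b δ) *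
        (1 - deriv (fun v => treeGenFun a (genFun b v)) δ)) ≠ 0 ∧
      Tendsto (fun R : ℕ => π.toMeasure.real {s : ℕ × ℕ | R ≤ s.2} * δ ^ R) atTop
        (𝓝 (((1 - lamA - lamB) * δ * (δ - 1)) / ((1 - genFun b δ) *
          (1 - deriv (fun v => treeGenFun a (genFun b v)) δ)))) := by
  have hδ0 : 0 < δ := by linarith
  have hab : egf (tail a) 1 + egf (tail b) 1 < 1 := by
    rw [hA, hB, ← ENNReal.ofReal_add hA0 hB0]
    exact ENNReal.ofReal_lt_one.2 hlam
  have ha : egf (tail a) 1 < 1 := lt_of_le_of_lt le_self_add hab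
  have hne : treeGenFun a (genFun b δ) ≠ 0 := by rw [hfix]; exact hδ0.ne'
  obtain ⟨hBfin, hTfin, hTeq⟩ := finite_of_treeGenFun_ne_zero hδ0.le hne
  have hD : 1 < ENNReal.ofReal δ := by rwa [ENNReal.one_lt_ofReal]
  have hb : ∃ n, tail b n ≠ 0 := by
    by_contra! h
    -- otherwise `B = 1`, and `T_A(B(δ)) = T_A(1) = 1`
    have h1 := egf_add_egf_tail b (ENNReal.ofReal δ)
    have h2 : egf (tail b) (ENNReal.ofReal δ) = 0 := by simp [egf, h]
    rw [h2, mul_zero, add_zero, add_zero, b.tsum_coe] at h1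
    rw [hTeq, h1, egf_one, tsum_treeCoeff a ha, ENNReal.toReal_one] at hfix
    linarith
  have hB1 := one_lt_egf hb hD ENNReal.ofReal_ne_top hBfin
  obtain ⟨hSfin, hQfin⟩ := egf_stepCoeff_ne_top hb hD ENNReal.ofReal_ne_top hBfin hTfin
  have hS1 : egf (tail (treeCoeff a)) 1 ≠ ∞ := ne_top_of_le_ne_top hSfin (egf_mono _ hB1.le)
  obtain ⟨hκ, hQ1⟩ := empty_probability a b hA hB hA0 hB0 hlam hS1 hb hπ
  -- `T_A ∘ B` is given by its power series near `δ`, since it is continuous and nonzero there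
  have hnear : ∀ᶠ v in 𝓝 δ, 1 < v ∧ treeGenFun a (genFun b v) ≠ 0 :=
    (lt_mem_nhds hδ).and (hdiff.continuousAt.eventually_ne hne)
  obtain ⟨v, hδv, hv1, hv2⟩ : ∃ v, δ < v ∧ 1 < v ∧ treeGenFun a (genFun b v) ≠ 0 := by
    have h : ∀ᶠ v in 𝓝[>] δ, δ < v ∧ 1 < v ∧ treeGenFun a (genFun b v) ≠ 0 :=
      Eventually.and self_mem_nhdsWithin (nhdsWithin_le_nhds hnear)
    exact h.exists
  obtain ⟨hsd, hder⟩ := hasDerivAt_powerSeries (c := fun n => (stepCoeff a b n).toReal)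
    (fun n => ENNReal.toReal_nonneg) hδ0 hδv (treeGenFun_eq_step ha hb hv1 hv2).1
  set d := ∑' n : ℕ, (stepCoeff a b n).toReal * (n * δ ^ (n - 1)) with hd
  have hQδ := (treeGenFun_eq_step ha hb hδ hne).2
  set Qδ := ∑' n, (stepCoeff a b n).toReal * δ ^ n with hQδdef
  have hQone : Qδ = 1 := by
    have h1 : (δ - 1) * Qδ = (δ - 1) * 1 := by linarith
    exact mul_left_cancel₀ (by linarith) h1
  have hderiv : deriv (fun v => treeGenFun a (genFun b v)) δ = 1 + (δ - 1) * d := by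
    have h1 : HasDerivAt (fun v => 1 - (1 - v) * ∑' n, (stepCoeff a b n).toReal * v ^ n)
        (-((-1) * Qδ + (1 - δ) * d)) δ :=
      (((hasDerivAt_id δ).const_sub 1).mul hder).const_sub 1
    have h2 : (fun v => treeGenFun a (genFun b v)) =ᶠ[𝓝 δ]
        fun v => 1 - (1 - v) * ∑' n, (stepCoeff a b n).toReal * v ^ n :=
      hnear.mono fun v hv => (treeGenFun_eq_step ha hb hv.1 hv.2).2
    rw [(h1.congr_of_eventuallyEq h2).deriv, hQone]
    ring
  have hQe : egf (stepCoeff a b) (ENNReal.ofReal δ) = 1 := by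
    rw [← ENNReal.ofReal_toReal hQfin, ← (hasSum_toReal_egf hδ0.le hQfin).tsum_eq, ← hQδdef,
      hQone, ENNReal.ofReal_one]
  have hq0 : (stepCoeff a b 0).toReal < 1 := by
    have : stepCoeff a b 0 < 1 := lt_of_le_of_lt (by rw [egf_succ]; exact le_self_add) hQ1
    rw [← ENNReal.toReal_one]
    exact (ENNReal.toReal_lt_toReal this.ne_top ENNReal.one_ne_top).2 this
  have hq1 : stepCoeff a b 1 ≠ 0 := by
    intro h
    -- otherwise `Q` is constant, but `Q(1) < 1 = Q(δ)`
    have h0 : ∀ n, stepCoeff a b (n + 1) = 0 := fun n => le_antisymm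
      ((stepCoeff_antitone a b ha (ne_top_of_lt (lt_of_le_of_lt le_add_self hab)) hS1
        (by omega : 1 ≤ n + 1)).trans h.le) zero_le
    have hc : ∀ y, egf (stepCoeff a b) y = stepCoeff a b 0 := fun y => by
      rw [egf_succ]; simp [egf, h0]
    rw [hc] at hQ1 hQe
    exact hQ1.ne hQe
  have hdpos : 0 < d := by
    refine hsd.tsum_pos (fun n => by positivity) 1 ?_
    have := ENNReal.toReal_pos hq1 (coeff_ne_top (zero_lt_one.trans hD).ne' hQfin 1)
    simpa using this
  have hs : egf (forestTail a b) (ENNReal.ofReal δ) ≠ ∞ := by rwa [egf_forestTail]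
  have hvfin : ∀ n, shiftedLaw π n ≠ ∞ := coeff_ne_top one_ne_zero
    (by rw [egf_shiftedLaw_one]; exact ENNReal.one_ne_top)
  have hκpos : 0 < 1 - lamA - lamB := by linarith
  have hκfin : ∑' m, π (m, 0) ≠ ∞ := by
    intro h
    rw [h, ENNReal.toReal_top] at hκ
    linarith
  have lim := tendsto_tail_of_tendsto hδ (tendsto_shiftedLaw hδ0 hvfin hκfin
    (renewal_equation a b hab hS1 hb hπ) hQe hs hq0 hq1 hsd.hasSum)
  rw [← hd, hκ, egf_forestTail] at lim
  -- the value of `S(B(δ))`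
  have hgB : genFun b δ = (egf b (ENNReal.ofReal δ)).toReal := genFun_eq b hδ0.le
  have hBr : 1 < genFun b δ := by
    rw [hgB, ← ENNReal.toReal_one]
    exact (ENNReal.toReal_lt_toReal ENNReal.one_ne_top hBfin).2 hB1
  have hSval : (egf (tail (treeCoeff a)) (egf b (ENNReal.ofReal δ))).toReal =
      (δ - 1) / (genFun b δ - 1) := by
    have h := congrArg ENNReal.toReal (egf_add_egf_tail (treeCoeff a) (egf b (ENNReal.ofReal δ)))
    rw [tsum_treeCoeff a ha, ENNReal.toReal_add hTfin hSfin, ENNReal.toReal_add ENNReal.one_ne_top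
      (ENNReal.mul_ne_top hBfin hSfin), ENNReal.toReal_mul, ENNReal.toReal_one, ← hTeq, hfix,
      ← hgB] at h
    rw [eq_div_iff (by linarith)]
    linarith
  rw [hSval] at lim
  have hval : ((1 - lamA - lamB) * δ * (δ - 1)) / ((1 - genFun b δ) *
        (1 - deriv (fun v => treeGenFun a (genFun b v)) δ)) =
      (1 - lamA - lamB) * ((δ - 1) / (genFun b δ - 1)) / (δ * d) * (δ ^ 2 / (δ - 1)) := by
    have h1 : genFun b δ - 1 ≠ 0 := by linarith
    have h2 : δ - 1 ≠ 0 := by linarith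
    rw [hderiv, show (1 - genFun b δ) * (1 - (1 + (δ - 1) * d)) =
      (genFun b δ - 1) * ((δ - 1) * d) by ring]
    field_simp
  rw [hval]
  refine ⟨?_, ?_⟩
  · have h1 : 0 < genFun b δ - 1 := by linarith
    have h2 : 0 < δ - 1 := by linarith
    positivity
  · rw [← tendsto_add_atTop_iff_nat 2]
    refine lim.congr fun n => ?_
    rw [measureReal_snd_ge]

end TandemQueue

theorem mainTheorem5 {Ω : Type*} [MeasurableSpace Ω] (P : Measure Ω) [IsProbabilityMeasure P]
    (a b : PMF ℕ) (A B : ℕ → Ω → ℕ)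
    (hA : ∀ t, Measurable (A t)) (hB : ∀ t, Measurable (B t))
    (hA_law : ∀ t, P.map (A t) = a.toMeasure) (hB_law : ∀ t, P.map (B t) = b.toMeasure)
    (hA_indep : iIndepFun A P) (hB_indep : iIndepFun B P)
    (hAB_indep : IndepFun (fun ω t => A t ω) (fun ω t => B t ω) P)
    (lamA lamB : ℝ)
    (hlamA : HasSum (fun n : ℕ => (n : ℝ) * (a n).toReal) lamA)
    (hlamB : HasSum (fun n : ℕ => (n : ℝ) * (b n).toReal) lamB)
    (hlam : lamA + lamB < 1)
    (δ : ℝ) (hδ : IsGreatest (TandemQueue.fixedPoints a b) δ) (hδ_one : 1 < δ)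
    (hδ_diff : DifferentiableAt ℝ
      (fun v => TandemQueue.treeGenFun a (TandemQueue.genFun b v)) δ) :
    ∃ π : PMF (ℕ × ℕ),
      TandemQueue.IsStationary a b π ∧
      (∀ π' : PMF (ℕ × ℕ), TandemQueue.IsStationary a b π' → π' = π) ∧
      (∀ n m : ℕ, Tendsto (fun t => P.real {ω | TandemQueue.occupancy A B t ω = (n, m)})
        atTop (𝓝 (π (n, m)).toReal)) ∧
      (fun R : ℕ => π.toMeasure.real {s : ℕ × ℕ | R ≤ s.2}) ~[atTop]
        (fun R : ℕ =>
          ((1 - lamA - lamB) * δ * (δ - 1)) /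
            ((1 - TandemQueue.genFun b δ) *
              (1 - deriv (fun v => TandemQueue.treeGenFun a (TandemQueue.genFun b v)) δ)) *
            δ ^ (-(R : ℤ))) := by
  have hA0 : 0 ≤ lamA := hlamA.nonneg fun n => by positivity
  have hB0 : 0 ≤ lamB := hlamB.nonneg fun n => by positivity
  have hmA := TandemQueue.egf_tail_one_eq_mean hlamA
  have hmB := TandemQueue.egf_tail_one_eq_mean hlamB
  have hab : TandemQueue.egf (TandemQueue.tail a) 1 +
      TandemQueue.egf (TandemQueue.tail b) 1 < 1 := by
    rw [hmA, hmB, ← ENNReal.ofReal_add hA0 hB0]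
    exact ENNReal.ofReal_lt_one.2 hlam
  have ha0 := TandemQueue.pmf_zero_ne_zero (lt_of_le_of_lt le_self_add hab)
  have hb0 := TandemQueue.pmf_zero_ne_zero (lt_of_le_of_lt le_add_self hab)
  obtain ⟨π, hπ, hlim⟩ := TandemQueue.exists_stationary a b hab ha0
  refine ⟨π, hπ, fun π' hπ' => TandemQueue.stationary_unique a b ha0 hb0 hπ' hπ, ?_, ?_⟩
  · intro n m
    have h := (ENNReal.tendsto_toReal (π.apply_ne_top (n, m))).comp (hlim (n, m))
    refine h.congr fun t => ?_
    have hmeas : MeasurableSet {ω | TandemQueue.occupancy A B t ω = (n, m)} :=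
      TandemQueue.measurable_occupancy hA hB t (measurableSet_singleton (n, m))
    have h1 := TandemQueue.lintegral_occupancy a b hA hB hA_law hB_law hA_indep hB_indep hAB_indep t
      (fun s => if s = (n, m) then 1 else 0)
    rw [TandemQueue.expect_single] at h1
    rw [Function.comp, ← h1, measureReal_def, ← lintegral_indicator_one hmeas]
    congr 2
    funext ω
    simp [Set.indicator]
  · obtain ⟨hC, hT⟩ := TandemQueue.tendsto_measureReal_snd a b hmA hmB hA0 hB0 hlam hδ_one
      hδ.1.2.2.2 hδ_diff hπ
    have hδ0 : δ ≠ 0 := by linarith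
    have h := ((isEquivalent_const_iff_tendsto hC).2 hT).mul
      (IsEquivalent.refl (u := fun R : ℕ => δ ^ (-(R : ℤ))) (l := atTop))
    refine h.congr_left (Eventually.of_forall fun R => ?_)
    simp only [Pi.mul_apply, zpow_neg, zpow_natCast]
    rw [mul_assoc, mul_inv_cancel₀ (pow_ne_zero R hδ0), mul_one]
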